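/- **Setting.** There are $U\ge 1$ users; user $u$ has an unknown preference vector $\theta_u\in\mathbb R^d$ with $\|\theta_u\|_2\le 1$, and there is $\gamma>0$ with $\|\theta_u-\theta_v\|_2\ge\gamma$ whenever $\theta_u\ne\theta_v$. User $u$ has $N_u$ samples $(a_u^i,r_u^i)_{i\le N_u}$. *Actions:* $\rho$ is a distribution on the unit ball of $\mathbb R^d$ such that $\mathbb E_{a\sim\rho}[aa^\top]$ has smallest eigenvalue $\lambda_a>0$, and for every unit vector $x$ the variable $(x^\top a)^2$, $a\sim\rho$, has sub-Gaussian tails with variance proxy $\sigma^2>0$: for all $t\ge 0$, each of the probabilities that $(x^\top a)^2-\mathbb E(x^\top a)^2$ is $\ge t$, or is $\le -t$, is at most $e^{-t^2/(2\sigma^2)}$. Each action $a_u^i$ is selected, by an arbitrary rule, from a finite candidate set of at most $S$ vectors; for each user the candidates of all rounds are independent draws from $\rho$. Put $\tilde\lambda_a=\int_0^{\lambda_a}\bigl(1-e^{-(\lambda_a-x)^2/(2\sigma^2)}\bigr)^S\,dx$. *Rewards:* conditionally on $a_u^1,\dots,a_u^i$ and $r_u^1,\dots,r_u^{i-1}$,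 the reward $r_u^i$ is 1-sub-Gaussian with mean $\langle\theta_u,a_u^i\rangle$. **Algorithm.** For inputs $\alpha,\lambda,\delta,\hat\gamma$ let $M_u=\lambda I+\sum_i a_u^i(a_u^i)^\top$, $\hat\theta_u=M_u^{-1}\sum_i r_u^ia_u^i$, $$\mathrm{CI}_u=\frac{\sqrt{d\log(1+\frac{N_u}{\lambda d})+2\log\frac{2U}{\delta}}+\sqrt\lambda}{\sqrt{\tilde\lambda_aN_u/2}},\qquad N_{\min}=\frac{16}{\tilde\lambda_a^2}\log\frac{8Ud}{\tilde\lambda_a^2\delta}.$$ Two distinct users $u,v$ are connected iff $\|\hat\theta_u-\hat\theta_v\|_2<\hat\gamma-\alpha(\mathrm{CI}_u+\mathrm{CI}_v)$ and $\min\{N_u,N_v\}\ge N_{\min}$. Let $\mathcal V_{\hat\gamma}(u)$ consist of $u$ and the users connected to $u$, $\mathcal R_{\hat\gamma}(u)=\{v\in\mathcal V_{\hat\gamma}(u):\theta_v=\theta_u\}$ and $\mathcal W_{\hat\gamma}(u)=\{v\in\mathcal V_{\hat\gamma}(u):\theta_v\ne\theta_u\}$. **Lemma.** Let $\alpha\ge1$,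 $\lambda>0$, $\delta\in(0,1)$, $\hat\gamma\ge0$ with $$\lambda\le d\log\Bigl(1+\frac{\min_uN_u}{\lambda d}\Bigr)+2\log\frac{2U}{\delta},\qquad \delta\le\frac{2U}{1+\max_uN_u/(\lambda d)}.$$ Then there exist random variables $\alpha_r(u,v)$ and $\alpha_w(u,v)$, one of each for every pair of users, which always satisfy $$\alpha_r(u,v)\in\Bigl[\tfrac{\sqrt{\tilde\lambda_a}}{4(\alpha+1)\sqrt{\log(2U/\delta)\max\{2,d\}}},\ \tfrac{\sqrt{\tilde\lambda_a}}{2\alpha\sqrt{\log(2U/\delta)}}\Bigr),\qquad \alpha_w(u,v)\in\Bigl(0,\ \tfrac{\sqrt{\tilde\lambda_a}}{2(\alpha-1)\sqrt{\log(2U/\delta)}}\Bigr]$$ (for $\alpha=1$ the second range is $(0,\infty)$), such that with probability at least $1-\delta$ the following holds simultaneously for all users $u$. If $N_u\ge N_{\min}$, then $$\mathcal R_{\hat\gamma}(u)=\{u\}\cup\Bigl\{v:\theta_u=\theta_v,\ \tfrac1{\sqrt{N_u}}+\tfrac1{\sqrt{N_v}}\le\alpha_r(u,v)\,\hat\gamma,\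 N_v\ge N_{\min}\Bigr\},$$ $$\mathcal W_{\hat\gamma}(u)=\Bigl\{v:\gamma\le\|\theta_u-\theta_v\|_2\le\hat\gamma,\ \tfrac1{\sqrt{N_u}}+\tfrac1{\sqrt{N_v}}\le\alpha_w(u,v)(\hat\gamma-\gamma),\ N_v\ge N_{\min}\Bigr\}.$$ If $N_u<N_{\min}$, then $\mathcal R_{\hat\gamma}(u)=\{u\}$ and $\mathcal W_{\hat\gamma}(u)=\emptyset$. -/

import Mathlib

open MeasureTheory ProbabilityTheory Set
open scoped RealInnerProductSpace

noncomputable section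

namespace OffClusBand

/-- Actions and preference vectors live in `ℝ^d` with the Euclidean norm. -/
abbrev Vec (d : ℕ) := EuclideanSpace ℝ (Fin d)

/-- A random offline dataset for `U` users: user `u` has `N u` samples
`(action u i, reward u i)`, `i = 0, …, N u - 1`. -/
structure Dataset (Ω : Type*) [MeasurableSpace Ω] (U d : ℕ) where
  N : Fin U → ℕ
  action : (u : Fin U) → Fin (N u) → Ω → Vec d
  reward : (u : Fin U) → Fin (N u) → Ω → ℝ
  measurable_action : ∀ u i, Measurable (action u i)
  measurable_reward : ∀ u i, Measurable (reward u i)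

/-! ### The action distribution -/

/-- The matrix `E_{a ∼ ρ}[a aᵀ]`. -/
def secondMoment {d : ℕ} (ρ : Measure (Vec d)) : Matrix (Fin d) (Fin d) ℝ :=
  Matrix.of fun i j => ∫ a, a i * a j ∂ρ

/-- `ρ` is a distribution on the unit ball whose matrix `E[a aᵀ]` has smallest eigenvalue
`lamA > 0`, and for every unit vector `x` the variable `⟨x, a⟩²` has sub-Gaussian tails around its
mean with variance proxy `σ²`. -/
structure RegularLaw {d : ℕ} (ρ : Measure (Vec d)) (lamA σ : ℝ) : Prop where
  isProbability : IsProbabilityMeasure ρ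
  norm_le_one : ∀ᵐ a ∂ρ, ‖a‖ ≤ 1
  isLeast_eigenvalue : IsLeast (spectrum ℝ (secondMoment ρ)) lamA
  lamA_pos : 0 < lamA
  sigma_pos : 0 < σ
  upper_tail : ∀ x : Vec d, ‖x‖ = 1 → ∀ t : ℝ, 0 ≤ t →
    ρ.real {a | (∫ b, ⟪x, b⟫ ^ 2 ∂ρ) + t ≤ ⟪x, a⟫ ^ 2} ≤ Real.exp (-t ^ 2 / (2 * σ ^ 2))
  lower_tail : ∀ x : Vec d, ‖x‖ = 1 → ∀ t : ℝ, 0 ≤ t →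
    ρ.real {a | ⟪x, a⟫ ^ 2 ≤ (∫ b, ⟪x, b⟫ ^ 2 ∂ρ) - t} ≤ Real.exp (-t ^ 2 / (2 * σ ^ 2))

/-- The smoothed regularity parameter. -/
def smoothedRegularity (lamA σ : ℝ) (S : ℕ) : ℝ :=
  ∫ x in (0 : ℝ)..lamA, (1 - Real.exp (-(lamA - x) ^ 2 / (2 * σ ^ 2))) ^ S

/-- Every action of every user is selected, by an arbitrary rule, from a finite candidate set of
at most `S` vectors; for each user the candidates (over all rounds) are independent draws
from `ρ`. -/
def SelectedFromCandidates {Ω : Type*} [MeasurableSpace Ω] (μ : Measure Ω) {U d : ℕ}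
    (D : Dataset Ω U d) (ρ : Measure (Vec d)) (S : ℕ) : Prop :=
  ∀ u, ∃ (K : Fin (D.N u) → ℕ) (c : (i : Fin (D.N u)) → Fin (K i) → Ω → Vec d),
    (∀ i, K i ≤ S) ∧
    (∀ i k, Measurable (c i k)) ∧
    iIndepFun (fun p : (Σ i : Fin (D.N u), Fin (K i)) => c p.1 p.2) μ ∧
    (∀ i k, μ.map (c i k) = ρ) ∧
    ∀ i, ∀ᵐ ω ∂μ, ∃ k, D.action u i ω = c i k ω

/-! ### The rewards -/

/-- The σ-algebra generated by the actions of user `u` up to and including round `i` and the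
rewards of user `u` strictly before round `i`. -/
@[reducible] def Dataset.history {Ω : Type*} [MeasurableSpace Ω] {U d : ℕ} (D : Dataset Ω U d)
    (u : Fin U) (i : Fin (D.N u)) : MeasurableSpace Ω :=
  (⨆ j : Fin (D.N u), ⨆ _ : j ≤ i, MeasurableSpace.comap (D.action u j) inferInstance) ⊔
  (⨆ j : Fin (D.N u), ⨆ _ : j < i, MeasurableSpace.comap (D.reward u j) inferInstance)

/-- Given the past and the current action `a`, the reward of user `u` is 1-sub-Gaussian around
`⟨θ_u, a⟩` (in particular its conditional mean is `⟨θ_u, a⟩`). -/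
def SubGaussianRewards {Ω : Type*} [MeasurableSpace Ω] (μ : Measure Ω) {U d : ℕ}
    (D : Dataset Ω U d) (θ : Fin U → Vec d) : Prop :=
  ∀ (u : Fin U) (i : Fin (D.N u)) (t : ℝ),
    Integrable (fun ω => Real.exp (t * (D.reward u i ω - ⟪θ u, D.action u i ω⟫))) μ ∧
    ∀ᵐ ω ∂μ,
      (μ[fun ω' => Real.exp (t * (D.reward u i ω' - ⟪θ u, D.action u i ω'⟫)) | D.history u i]) ω
        ≤ Real.exp (t ^ 2 / 2)

/-! ### The statistics and the graph computed by the algorithm Off-C²LUB -/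

variable {Ω : Type*} [MeasurableSpace Ω] {U d : ℕ}

/-- `M_u = λ I + ∑ᵢ aᵢ aᵢᵀ`. -/
def Dataset.gram (D : Dataset Ω U d) (lam : ℝ) (u : Fin U) (ω : Ω) :
    Matrix (Fin d) (Fin d) ℝ :=
  lam • (1 : Matrix (Fin d) (Fin d) ℝ) +
    ∑ i, Matrix.vecMulVec (D.action u i ω).ofLp (D.action u i ω).ofLp

/-- `b_u = ∑ᵢ rᵢ aᵢ`. -/
def Dataset.moment (D : Dataset Ω U d) (u : Fin U) (ω : Ω) : Vec d :=
  ∑ i, D.reward u i ω • D.action u i ω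

/-- The ridge estimate `M_u⁻¹ b_u`. -/
def Dataset.ridge (D : Dataset Ω U d) (lam : ℝ) (u : Fin U) (ω : Ω) : Vec d :=
  WithLp.toLp 2 (Matrix.mulVec (D.gram lam u ω)⁻¹ (D.moment u ω).ofLp)

/-- The confidence radius `CI_u` (`lamT` is the smoothed regularity parameter). -/
def Dataset.CI (D : Dataset Ω U d) (lamT lam δ : ℝ) (u : Fin U) : ℝ :=
  (Real.sqrt (d * Real.log (1 + D.N u / (lam * d)) + 2 * Real.log (2 * U / δ)) + Real.sqrt lam) /
    Real.sqrt (lamT * D.N u / 2)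

/-- `N_min = (16 / λ̃²) log (8 U d / (λ̃² δ))`. -/
def Nmin (U d : ℕ) (lamT δ : ℝ) : ℝ :=
  16 / lamT ^ 2 * Real.log (8 * U * d / (lamT ^ 2 * δ))

/-- The random graph produced by the cluster phase. -/
def Dataset.graph (D : Dataset Ω U d) (lamT α lam δ γhat : ℝ) (ω : Ω) : SimpleGraph (Fin U) where
  Adj u v := u ≠ v ∧
    ‖D.ridge lam u ω - D.ridge lam v ω‖ < γhat - α * (D.CI lamT lam δ u + D.CI lamT lam δ v) ∧
    Nmin U d lamT δ ≤ min (D.N u : ℝ) (D.N v : ℝ)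
  symm := ⟨by
    intro u v h
    refine ⟨h.1.symm, ?_, ?_⟩
    · rw [norm_sub_rev, add_comm (D.CI lamT lam δ v)]; exact h.2.1
    · rw [min_comm]; exact h.2.2⟩
  loopless := ⟨fun _ h => h.1 rfl⟩

/-- `u` together with its neighbours in the graph. -/
def Dataset.nbhd (D : Dataset Ω U d) (lamT α lam δ γhat : ℝ) (u : Fin U) (ω : Ω) :
    Set (Fin U) :=
  {u} ∪ {v | (D.graph lamT α lam δ γhat ω).Adj u v}

/-- `R(u)`: the users in `V(u)` with the same preference vector as `u`. -/
def Dataset.R (D : Dataset Ω U d) (θ : Fin U → Vec d) (lamT α lam δ γhat : ℝ) (u : Fin U)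
    (ω : Ω) : Set (Fin U) :=
  {v | v ∈ D.nbhd lamT α lam δ γhat u ω ∧ θ u = θ v}

/-- `W(u)`: the users in `V(u)` with a preference vector different from that of `u`. -/
def Dataset.W (D : Dataset Ω U d) (θ : Fin U → Vec d) (lamT α lam δ γhat : ℝ) (u : Fin U)
    (ω : Ω) : Set (Fin U) :=
  {v | v ∈ D.nbhd lamT α lam δ γhat u ω ∧ θ u ≠ θ v}

end OffClusBand

end

noncomputable section

namespace OffClusBand

/-!
The ridge error `θ̂_u - θ_u` is controlled by two probabilistic estimates. Averaging the exponential
supermartingale `exp (⟪x, ξ⟫ - xᵀ V x / 2)` over a Gaussian direction `x` (method of mixtures)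
bounds the noise `ξ` in the norm of the inverse Gram matrix. The Gram matrix itself has smallest
eigenvalue at least `λ̃ N_u / 2`: for a fixed unit vector `x`, the smallest of the `S` candidate
values of `⟪x, a⟫²` has mean at least `λ̃` whatever the selection rule, so a Chernoff bound applies,
and a union bound over a finite net of the sphere makes it uniform in `x`. Hence, with probability
at least `1 - δ`, every user with `N_u ≥ N_min` satisfies `‖θ̂_u - θ_u‖ < CI_u`.

On that event everything is the triangle inequality, since `CI_u` is of order `1 / √N_u`. The
factors `α_r` and `α_w` may depend on the random graph: they are chosen edge by edge, as large as
needed for the edges that are present and as small as needed for those that are absent.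
-/

section ConditionalSubGaussian

variable {Ω : Type*} {m m0 : MeasurableSpace Ω} {μ : Measure Ω}

lemma exists_seq_finite_range_tendsto {_ : MeasurableSpace Ω} {t : Ω → ℝ} (ht : Measurable t) :
    ∃ T : ℕ → Ω → ℝ, (∀ k, Measurable (T k)) ∧ (∀ k, (range (T k)).Finite) ∧
      ∀ ω, Filter.Tendsto (fun k => T k ω) Filter.atTop (nhds (t ω)) :=
  ⟨fun k => ht.stronglyMeasurable.approx k, fun _ => SimpleFunc.measurable _,
    fun _ => SimpleFunc.finite_range _, ht.stronglyMeasurable.tendsto_approx⟩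

lemma lintegral_mul_le_of_forall_setLIntegral_le [SigmaFinite μ] (hm : m ≤ m0) {f W : Ω → ENNReal}
    (hf : Measurable[m0] f) (hle : ∀ A, MeasurableSet[m] A → ∫⁻ ω in A, f ω ∂μ ≤ μ A)
    (hW : Measurable[m] W) : ∫⁻ ω, f ω * W ω ∂μ ≤ ∫⁻ ω, W ω ∂μ := by
  have htrim : (μ.withDensity f).trim hm ≤ μ.trim hm := Measure.le_iff.2 fun A hA => by
    rw [trim_measurableSet_eq hm hA, trim_measurableSet_eq hm hA, withDensity_apply _ (hm A hA)]
    exact hle A hA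
  calc ∫⁻ ω, f ω * W ω ∂μ = ∫⁻ ω, W ω ∂μ.withDensity f :=
        (lintegral_withDensity_eq_lintegral_mul _ hf (hW.mono hm le_rfl)).symm
    _ = ∫⁻ ω, W ω ∂(μ.withDensity f).trim hm := (lintegral_trim hm hW).symm
    _ ≤ ∫⁻ ω, W ω ∂μ.trim hm := lintegral_mono' htrim le_rfl
    _ = ∫⁻ ω, W ω ∂μ := lintegral_trim hm hW

/-- `η` is 1-sub-Gaussian (in particular centred) conditionally on the σ-algebra `m`. Mathlib's
`HasCondSubgaussianMGF` is not used since it needs a standard Borel sample space. -/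
structure CondSubGaussian (m : MeasurableSpace Ω) {m0 : MeasurableSpace Ω} (μ : Measure Ω)
    (η : Ω → ℝ) : Prop where
  measurable : Measurable η
  integrable_exp : ∀ t : ℝ, Integrable (fun ω => Real.exp (t * η ω)) μ
  condExp_exp_le : ∀ t : ℝ, ∀ᵐ ω ∂μ,
    (μ[fun ω' => Real.exp (t * η ω') | m]) ω ≤ Real.exp (t ^ 2 / 2)

/-- The exponential weight `exp (t y - t² / 2)`, of mean at most one when `y` is a 1-sub-Gaussian
variable. -/
def expWeight (t y : ℝ) : ENNReal := ENNReal.ofReal (Real.exp (t * y - t ^ 2 / 2))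

@[fun_prop]
lemma measurable_expWeight {_ : MeasurableSpace Ω} {t y : Ω → ℝ} (ht : Measurable t)
    (hy : Measurable y) : Measurable fun ω => expWeight (t ω) (y ω) := by
  unfold expWeight
  fun_prop

lemma continuous_expWeight_left (y : ℝ) : Continuous fun t => expWeight t y := by
  unfold expWeight
  exact ENNReal.continuous_ofReal.comp (by fun_prop)

lemma prod_expWeight {ι : Type*} (s : Finset ι) (t y : ι → ℝ) :
    ∏ i ∈ s, expWeight (t i) (y i) =
      ENNReal.ofReal (Real.exp (∑ i ∈ s, t i * y i - (∑ i ∈ s, t i ^ 2) / 2)) := by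
  simp only [expWeight]
  rw [← ENNReal.ofReal_prod_of_nonneg fun _ _ => (Real.exp_pos _).le, ← Real.exp_sum,
    Finset.sum_sub_distrib, Finset.sum_div]

namespace CondSubGaussian

variable {η : Ω → ℝ}

lemma setLIntegral_expWeight_const_le [IsFiniteMeasure μ] (h : CondSubGaussian m μ η)
    (hm : m ≤ m0) (t : ℝ) {A : Set Ω} (hA : MeasurableSet[m] A) :
    ∫⁻ ω in A, expWeight t (η ω) ∂μ ≤ μ A := by
  have hint : Integrable (fun ω => Real.exp (t * η ω - t ^ 2 / 2)) μ := by
    simp_rw [Real.exp_sub]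
    exact (h.integrable_exp t).div_const _
  simp only [expWeight]
  rw [← ofReal_integral_eq_lintegral_ofReal hint.integrableOn
    (Filter.Eventually.of_forall fun ω => (Real.exp_pos _).le)]
  refine ENNReal.ofReal_le_of_le_toReal ?_
  simp_rw [Real.exp_sub]
  rw [integral_div, div_le_iff₀ (Real.exp_pos _), ← setIntegral_condExp hm (h.integrable_exp t) hA]
  calc ∫ ω in A, (μ[fun ω' => Real.exp (t * η ω') | m]) ω ∂μ
      ≤ ∫ _ω in A, Real.exp (t ^ 2 / 2) ∂μ :=
        setIntegral_mono_ae integrable_condExp.integrableOn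
          (integrableOn_const (measure_ne_top _ _)) (h.condExp_exp_le t)
    _ = (μ A).toReal * Real.exp (t ^ 2 / 2) := by
        rw [setIntegral_const, smul_eq_mul, Measure.real]

lemma setLIntegral_expWeight_of_finite_range_le [IsFiniteMeasure μ] (h : CondSubGaussian m μ η)
    (hm : m ≤ m0) {t : Ω → ℝ} (ht : Measurable[m] t)
    (hfin : (range t).Finite) {A : Set Ω} (hA : MeasurableSet[m] A) :
    ∫⁻ ω in A, expWeight (t ω) (η ω) ∂μ ≤ μ A := by
  have hpart : A = ⋃ k ∈ hfin.toFinset, A ∩ t ⁻¹' {k} := by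
    ext ω
    simp
  have hmeas : ∀ k, MeasurableSet[m] (A ∩ t ⁻¹' {k}) := fun k =>
    hA.inter (ht (measurableSet_singleton k))
  have hdisj : (hfin.toFinset : Set ℝ).PairwiseDisjoint fun k => A ∩ t ⁻¹' {k} := fun k _ l _ hkl =>
    ((disjoint_singleton.2 hkl).preimage t).mono inter_subset_right inter_subset_right
  calc ∫⁻ ω in A, expWeight (t ω) (η ω) ∂μ
      = ∑ k ∈ hfin.toFinset, ∫⁻ ω in A ∩ t ⁻¹' {k}, expWeight (t ω) (η ω) ∂μ := by
        conv_lhs => rw [hpart]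
        exact lintegral_biUnion_finset hdisj (fun k _ => hm _ (hmeas k)) _
    _ = ∑ k ∈ hfin.toFinset, ∫⁻ ω in A ∩ t ⁻¹' {k}, expWeight k (η ω) ∂μ :=
        Finset.sum_congr rfl fun k _ => setLIntegral_congr_fun (hm _ (hmeas k)) fun ω hω => by
          simp only [show t ω = k from hω.2]
    _ ≤ ∑ k ∈ hfin.toFinset, μ (A ∩ t ⁻¹' {k}) :=
        Finset.sum_le_sum fun k _ => h.setLIntegral_expWeight_const_le hm k (hmeas k)
    _ = μ A := by
        rw [← measure_biUnion_finset hdisj fun k _ => hm _ (hmeas k), ← hpart]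

lemma setLIntegral_expWeight_le [IsFiniteMeasure μ] (h : CondSubGaussian m μ η) (hm : m ≤ m0)
    {t : Ω → ℝ} (ht : Measurable[m] t) {A : Set Ω} (hA : MeasurableSet[m] A) :
    ∫⁻ ω in A, expWeight (t ω) (η ω) ∂μ ≤ μ A := by
  obtain ⟨T, hT, hTfin, hTt⟩ := exists_seq_finite_range_tendsto ht
  have hlim : ∀ ω, Filter.Tendsto (fun k => expWeight (T k ω) (η ω)) Filter.atTop
      (nhds (expWeight (t ω) (η ω))) := fun ω =>
    ((continuous_expWeight_left (η ω)).tendsto _).comp (hTt ω)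
  have hTm : ∀ k, Measurable[m0] fun ω => expWeight (T k ω) (η ω) := fun k =>
    measurable_expWeight ((hT k).mono hm le_rfl) h.measurable
  calc ∫⁻ ω in A, expWeight (t ω) (η ω) ∂μ
      = ∫⁻ ω in A, Filter.liminf (fun k => expWeight (T k ω) (η ω)) Filter.atTop ∂μ :=
        lintegral_congr fun ω => (hlim ω).liminf_eq.symm
    _ ≤ Filter.liminf (fun k => ∫⁻ ω in A, expWeight (T k ω) (η ω) ∂μ) Filter.atTop :=
        lintegral_liminf_le hTm
    _ ≤ Filter.liminf (fun _ => μ A) Filter.atTop := Filter.liminf_le_liminf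
        (Filter.Eventually.of_forall fun k =>
          h.setLIntegral_expWeight_of_finite_range_le hm (hT k) (hTfin k) hA)
    _ = μ A := Filter.liminf_const _

lemma lintegral_expWeight_mul_le [IsFiniteMeasure μ] (h : CondSubGaussian m μ η) (hm : m ≤ m0)
    {t : Ω → ℝ} (ht : Measurable[m] t) {W : Ω → ENNReal} (hW : Measurable[m] W) :
    ∫⁻ ω, expWeight (t ω) (η ω) * W ω ∂μ ≤ ∫⁻ ω, W ω ∂μ :=
  lintegral_mul_le_of_forall_setLIntegral_le hm
    (measurable_expWeight (ht.mono hm le_rfl) h.measurable)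
    (fun _ hA => h.setLIntegral_expWeight_le hm ht hA) hW

lemma lintegral_prod_expWeight_le_one [IsProbabilityMeasure μ] {N : ℕ}
    {ℱ : Fin N → MeasurableSpace Ω} {η t : Fin N → Ω → ℝ}
    (hη : ∀ i, CondSubGaussian (ℱ i) μ (η i)) (hℱ : ∀ i, ℱ i ≤ m0)
    (hηm : ∀ i j, j < i → Measurable[ℱ i] (η j)) (ht : ∀ i j, j ≤ i → Measurable[ℱ i] (t j)) :
    ∫⁻ ω, ∏ i, expWeight (t i ω) (η i ω) ∂μ ≤ 1 := by
  induction N with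
  | zero => simp
  | succ N ih =>
    simp_rw [Fin.prod_univ_castSucc, mul_comm _ (expWeight _ _)]
    refine ((hη (Fin.last N)).lintegral_expWeight_mul_le (hℱ _) (ht _ _ le_rfl) ?_).trans
      (ih (fun i => hη i.castSucc) (fun i => hℱ _) (fun i j hij => hηm _ _ hij)
        fun i j hij => ht _ _ hij)
    exact Finset.measurable_prod _ fun j _ =>
      measurable_expWeight (ht _ _ (Fin.castSucc_lt_last j).le) (hηm _ _ (Fin.castSucc_lt_last j))

end CondSubGaussian

end ConditionalSubGaussian

section PositiveDefinite

variable {n : Type*} [Fintype n] [DecidableEq n] {M : Matrix n n ℝ}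

open scoped MatrixOrder in
lemma exists_linearMap_inner_eq_of_posDef (hM : M.PosDef) :
    ∃ T : EuclideanSpace ℝ n →ₗ[ℝ] EuclideanSpace ℝ n, 0 < LinearMap.det T ∧
      LinearMap.det T ^ 2 = M.det ∧ ∀ x y, ⟪T x, T y⟫ = ⟪x, M.toEuclideanLin y⟫ := by
  let B := CFC.sqrt M
  have hBB : B * B = M := CFC.sqrt_mul_sqrt_self _ (Matrix.nonneg_iff_posSemidef.2 hM.posSemidef)
  have hB : B.PosSemidef := Matrix.nonneg_iff_posSemidef.1 (CFC.sqrt_nonneg _)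
  have hdet : LinearMap.det B.toEuclideanLin = B.det := by
    rw [Matrix.toEuclideanLin, Matrix.toLpLin_eq_toLin, LinearMap.det_toLin]
  have hdet_sq : B.det ^ 2 = M.det := by rw [← hBB, Matrix.det_mul, sq]
  have hdet_ne : B.det ≠ 0 := fun h => hM.det_pos.ne' (by rw [← hdet_sq, h, zero_pow two_ne_zero])
  refine ⟨B.toEuclideanLin, hdet ▸ hB.det_nonneg.lt_of_ne' hdet_ne, hdet ▸ hdet_sq, fun x y => ?_⟩
  rw [Matrix.isSymmetric_toEuclideanLin_iff.2 hB.isHermitian x _, ← hBB]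
  congr 1
  ext j
  simp [Matrix.mulVec_mulVec]

lemma norm_sq_eq_inner_toEuclideanLin {T : EuclideanSpace ℝ n →ₗ[ℝ] EuclideanSpace ℝ n}
    (hT : ∀ x y, ⟪T x, T y⟫ = ⟪x, M.toEuclideanLin y⟫) (x : EuclideanSpace ℝ n) :
    ‖T x‖ ^ 2 = ⟪x, M.toEuclideanLin x⟫ := by
  rw [← real_inner_self_eq_norm_sq, hT]

lemma toEuclideanLin_inv_mulVec (hM : IsUnit M.det) (v : EuclideanSpace ℝ n) :
    M.toEuclideanLin (WithLp.toLp 2 (Matrix.mulVec M⁻¹ v.ofLp)) = v := by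
  ext j
  simp [Matrix.mulVec_mulVec, Matrix.mul_nonsing_inv _ hM]

lemma det_le_trace_div_pow_card [Nonempty n] (hM : M.PosSemidef) :
    M.det ≤ (M.trace / Fintype.card n) ^ Fintype.card n := by
  have hdet : 0 ≤ ∏ i, hM.isHermitian.eigenvalues i :=
    Finset.prod_nonneg fun i _ => hM.eigenvalues_nonneg i
  have hmean := Real.geom_mean_le_arith_mean Finset.univ (fun _ => 1) hM.isHermitian.eigenvalues
    (fun _ _ => zero_le_one) (by simpa using Fintype.card_pos) fun i _ => hM.eigenvalues_nonneg i
  simp only [Real.rpow_one, Finset.sum_const, Finset.card_univ, nsmul_eq_mul, mul_one,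
    one_mul] at hmean
  calc M.det = ((∏ i, hM.isHermitian.eigenvalues i) ^ (Fintype.card n : ℝ)⁻¹) ^
        Fintype.card n := by
        rw [Real.rpow_inv_natCast_pow hdet Fintype.card_ne_zero,
          hM.isHermitian.det_eq_prod_eigenvalues]
        rfl
    _ ≤ _ := by
        rw [hM.isHermitian.trace_eq_sum_eigenvalues]
        exact pow_le_pow_left₀ (Real.rpow_nonneg hdet _) hmean _

lemma mul_norm_le_sqrt_of_norm_toEuclideanLin_le_one {lam : ℝ} (hlam : 0 < lam)
    (hle : ∀ x : EuclideanSpace ℝ n, lam * ‖x‖ ^ 2 ≤ ⟪x, M.toEuclideanLin x⟫)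
    {T : EuclideanSpace ℝ n →ₗ[ℝ] EuclideanSpace ℝ n}
    (hT : ∀ x y, ⟪T x, T y⟫ = ⟪x, M.toEuclideanLin y⟫)
    {z : EuclideanSpace ℝ n} (hz : ‖M.toEuclideanLin z‖ ≤ 1) : lam * ‖T z‖ ≤ √lam := by
  have hsq : ‖T z‖ ^ 2 ≤ ‖z‖ := by
    rw [norm_sq_eq_inner_toEuclideanLin hT]
    exact (real_inner_le_norm _ _).trans (mul_le_of_le_one_right (norm_nonneg z) hz)
  have hz_sq : lam * ‖z‖ ^ 2 ≤ ‖z‖ :=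
    (hle z).trans ((norm_sq_eq_inner_toEuclideanLin hT z).symm.le.trans hsq)
  have hz_le : lam * ‖z‖ ≤ 1 := by
    rcases (norm_nonneg z).eq_or_lt with h0 | h0
    · simp [← h0]
    · exact le_of_mul_le_mul_right (by linarith) h0
  refine Real.le_sqrt_of_sq_le ?_
  calc (lam * ‖T z‖) ^ 2 = lam ^ 2 * ‖T z‖ ^ 2 := mul_pow _ _ 2
    _ ≤ lam ^ 2 * ‖z‖ := by gcongr
    _ = lam * (lam * ‖z‖) := by ring
    _ ≤ lam := mul_le_of_le_one_right hlam.le hz_le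

/-- The solution `y = w - lam • z` of the linear system is measured in the norm of `M`, in which
the noise part `w` and the bias part `lam • z` have size at most `β` and `√lam`. -/
lemma norm_lt_of_toEuclideanLin_eq_sub_smul (hM : M.PosDef) {lam κ β : ℝ} (hlam : 0 < lam)
    (hκ : 0 < κ) (hβ : 0 ≤ β)
    (hle : ∀ x : EuclideanSpace ℝ n, (lam + κ) * ‖x‖ ^ 2 ≤ ⟪x, M.toEuclideanLin x⟫)
    {w y θ : EuclideanSpace ℝ n} (hw : ⟪w, M.toEuclideanLin w⟫ ≤ β ^ 2) (hθ : ‖θ‖ ≤ 1)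
    (hy : M.toEuclideanLin y = M.toEuclideanLin w - lam • θ) :
    ‖y‖ < (β + √lam) / √κ := by
  obtain ⟨T, -, -, hT⟩ := exists_linearMap_inner_eq_of_posDef hM
  set z : EuclideanSpace ℝ n := WithLp.toLp 2 (Matrix.mulVec M⁻¹ θ.ofLp)
  have hz : M.toEuclideanLin z = θ := toEuclideanLin_inv_mulVec hM.det_pos.ne'.isUnit θ
  have hTw : ‖T w‖ ≤ β :=
    abs_le_of_sq_le_sq' (by rwa [norm_sq_eq_inner_toEuclideanLin hT]) hβ |>.2
  have hTz : lam * ‖T z‖ ≤ √lam :=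
    mul_norm_le_sqrt_of_norm_toEuclideanLin_le_one hlam
      (fun x => le_trans (by gcongr; linarith) (hle x)) hT (hz ▸ hθ)
  have hTy : T y = T w - lam • T z := by
    rw [← sub_eq_zero, ← inner_self_eq_zero (𝕜 := ℝ), ← map_smul, ← map_sub, ← map_sub, hT,
      map_sub, map_sub, map_smul, hy, hz, sub_self, inner_zero_right]
  have hTy_le : ‖T y‖ ≤ β + √lam := by
    rw [hTy]
    refine (norm_sub_le _ _).trans (add_le_add hTw ?_)
    rwa [norm_smul, Real.norm_of_nonneg hlam.le]
  have hy_le : √(lam + κ) * ‖y‖ ≤ ‖T y‖ := by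
    refine abs_le_of_sq_le_sq' ?_ (norm_nonneg _) |>.2
    rw [mul_pow, Real.sq_sqrt (by positivity), norm_sq_eq_inner_toEuclideanLin hT]
    exact hle y
  have hlt : √κ < √(lam + κ) := Real.sqrt_lt_sqrt hκ.le (by linarith)
  rw [lt_div_iff₀ (Real.sqrt_pos.2 hκ)]
  rcases (norm_nonneg y).eq_or_lt with h0 | h0
  · rw [← h0, zero_mul]
    positivity
  · nlinarith

end PositiveDefinite

section GaussianIntegral

variable {n : Type*} [Fintype n]

/-- The Gaussian integral `∫ exp (-‖x‖² / 2) dx` over `ℝⁿ`. -/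
def gaussMass (n : Type*) [Fintype n] : ENNReal :=
  ∫⁻ x : EuclideanSpace ℝ n, ENNReal.ofReal (Real.exp (-(‖x‖ ^ 2 / 2)))

lemma gaussMass_ne_top : gaussMass n ≠ ⊤ := by
  have hint := GaussianFourier.integrable_cexp_neg_mul_sq_norm_add (V := EuclideanSpace ℝ n)
    (b := 1 / 2) (by norm_num) 0 0
  have hint' : Integrable fun x : EuclideanSpace ℝ n => Real.exp (-(‖x‖ ^ 2 / 2)) := by
    refine hint.norm.congr (Filter.Eventually.of_forall fun x => ?_)
    simp only [zero_mul, add_zero, Complex.norm_exp]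
    congr 1
    rw [show (-(1 / 2 : ℂ) * (‖x‖ : ℂ) ^ 2) = ((-(‖x‖ ^ 2 / 2) : ℝ) : ℂ) by push_cast; ring]
    exact Complex.ofReal_re _
  exact hint'.lintegral_lt_top.ne

lemma gaussMass_ne_zero : gaussMass n ≠ 0 := by
  rw [gaussMass, Ne, lintegral_eq_zero_iff (by fun_prop)]
  intro h
  have hfalse : ∀ᵐ _x : EuclideanSpace ℝ n, False := by
    filter_upwards [h] with x hx
    exact absurd (ENNReal.ofReal_eq_zero.1 hx) (not_le.2 (Real.exp_pos _))
  exact NeZero.ne (volume : Measure (EuclideanSpace ℝ n)) (by simpa using hfalse)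

lemma lintegral_exp_neg_norm_sq_linearMap {T : EuclideanSpace ℝ n →ₗ[ℝ] EuclideanSpace ℝ n}
    (hT : 0 < LinearMap.det T) :
    ∫⁻ x, ENNReal.ofReal (Real.exp (-(‖T x‖ ^ 2 / 2))) =
      ENNReal.ofReal (LinearMap.det T)⁻¹ * gaussMass n := by
  have hmap := lintegral_map (μ := (volume : Measure (EuclideanSpace ℝ n))) (g := T)
    (f := fun x => ENNReal.ofReal (Real.exp (-(‖x‖ ^ 2 / 2)))) (by fun_prop)
    T.continuous_of_finiteDimensional.measurable
  rw [← hmap, Measure.map_linearMap_addHaar_eq_smul_addHaar _ hT.ne', lintegral_smul_measure,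
    abs_of_pos (inv_pos.2 hT), gaussMass, smul_eq_mul]

lemma lintegral_exp_inner_sub_of_posDef [DecidableEq n] {M : Matrix n n ℝ} (hM : M.PosDef)
    (w : EuclideanSpace ℝ n) :
    ∫⁻ x, ENNReal.ofReal
        (Real.exp (⟪x, M.toEuclideanLin w⟫ - ⟪x, M.toEuclideanLin x⟫ / 2)) =
      ENNReal.ofReal (Real.exp (⟪w, M.toEuclideanLin w⟫ / 2) * (√M.det)⁻¹) * gaussMass n := by
  obtain ⟨T, hT0, hdet, hT⟩ := exists_linearMap_inner_eq_of_posDef hM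
  have hsquare : ∀ x, ⟪x, M.toEuclideanLin w⟫ - ⟪x, M.toEuclideanLin x⟫ / 2 =
      ⟪w, M.toEuclideanLin w⟫ / 2 + -(‖T (x - w)‖ ^ 2 / 2) := fun x => by
    rw [map_sub, norm_sub_sq_real]
    simp only [hT, norm_sq_eq_inner_toEuclideanLin hT]
    ring
  simp_rw [hsquare, Real.exp_add, ENNReal.ofReal_mul (Real.exp_pos _).le]
  rw [lintegral_const_mul' _ _ ENNReal.ofReal_ne_top, lintegral_sub_right_eq_self
    (fun x => ENNReal.ofReal (Real.exp (-(‖T x‖ ^ 2 / 2)))) w,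
    lintegral_exp_neg_norm_sq_linearMap hT0, ← hdet, Real.sqrt_sq hT0.le, mul_assoc]

lemma lintegral_exp_neg_mul_norm_sq {lam : ℝ} (hlam : 0 < lam) :
    ∫⁻ x : EuclideanSpace ℝ n, ENNReal.ofReal (Real.exp (-(lam * ‖x‖ ^ 2 / 2))) =
      ENNReal.ofReal (√(lam ^ Fintype.card n))⁻¹ * gaussMass n := by
  classical
  have h := lintegral_exp_inner_sub_of_posDef
    ((Matrix.PosDef.one (n := n) (R := ℝ)).smul hlam) 0
  simpa [Matrix.det_smul, inner_smul_right] using h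

end GaussianIntegral

section RidgeRegression

variable {n ι : Type*} [DecidableEq n] [Fintype ι] {lam : ℝ}

/-- The regularized Gram matrix `lam • 1 + ∑ᵢ aᵢ aᵢᵀ` of a design `a`. -/
def ridgeGram (lam : ℝ) (a : ι → EuclideanSpace ℝ n) : Matrix n n ℝ :=
  lam • (1 : Matrix n n ℝ) + ∑ i, Matrix.vecMulVec (a i).ofLp (a i).ofLp

lemma ridgeGram_posDef [Finite n] (hlam : 0 < lam) (a : ι → EuclideanSpace ℝ n) :
    (ridgeGram lam a).PosDef := by
  have := Fintype.ofFinite n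
  refine (Matrix.PosDef.one.smul hlam).add_posSemidef (Matrix.posSemidef_sum _ fun i _ => ?_)
  simpa using Matrix.posSemidef_vecMulVec_self_star (a i).ofLp

lemma continuous_ridgeGram :
    Continuous fun a : ι → EuclideanSpace ℝ n => ridgeGram lam a := by
  unfold ridgeGram
  refine continuous_const.add (continuous_finsetSum _ fun i _ => ?_)
  exact Continuous.matrix_vecMulVec (by fun_prop) (by fun_prop)

variable [Fintype n]

/-- The solution `M⁻¹ v` of the regularized normal equations with Gram matrix `M`. -/
def ridgeSolve (lam : ℝ) (a : ι → EuclideanSpace ℝ n) (v : EuclideanSpace ℝ n) :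
    EuclideanSpace ℝ n :=
  WithLp.toLp 2 (Matrix.mulVec (ridgeGram lam a)⁻¹ v.ofLp)

lemma toEuclideanLin_ridgeGram (a : ι → EuclideanSpace ℝ n) (x : EuclideanSpace ℝ n) :
    (ridgeGram lam a).toEuclideanLin x = lam • x + ∑ i, ⟪a i, x⟫ • a i := by
  ext j
  simp only [ridgeGram, Matrix.ofLp_toLpLin, Matrix.toLin'_apply, Matrix.add_mulVec,
    Matrix.smul_mulVec, Matrix.one_mulVec, Matrix.sum_mulVec, PiLp.add_apply, PiLp.smul_apply,
    Pi.add_apply, Pi.smul_apply, Finset.sum_apply, WithLp.ofLp_sum, WithLp.ofLp_smul,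
    Matrix.vecMulVec_mulVec]
  congr 1
  refine Finset.sum_congr rfl fun i _ => ?_
  simp [PiLp.inner_apply, dotProduct, mul_comm]

lemma inner_toEuclideanLin_ridgeGram_self (a : ι → EuclideanSpace ℝ n)
    (x : EuclideanSpace ℝ n) :
    ⟪x, (ridgeGram lam a).toEuclideanLin x⟫ = lam * ‖x‖ ^ 2 + ∑ i, ⟪a i, x⟫ ^ 2 := by
  rw [toEuclideanLin_ridgeGram, inner_add_right, inner_smul_right, inner_sum,
    real_inner_self_eq_norm_sq]
  congr 1
  refine Finset.sum_congr rfl fun i _ => ?_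
  rw [inner_smul_right, real_inner_comm, sq]

lemma toEuclideanLin_ridgeGram_ridgeSolve (hlam : 0 < lam) (a : ι → EuclideanSpace ℝ n)
    (v : EuclideanSpace ℝ n) : (ridgeGram lam a).toEuclideanLin (ridgeSolve lam a v) = v :=
  toEuclideanLin_inv_mulVec (ridgeGram_posDef hlam a).det_pos.ne'.isUnit v

lemma trace_ridgeGram (a : ι → EuclideanSpace ℝ n) :
    (ridgeGram lam a).trace = lam * Fintype.card n + ∑ i, ‖a i‖ ^ 2 := by
  have htrace : ∀ i, (Matrix.vecMulVec (a i).ofLp (a i).ofLp).trace = ‖a i‖ ^ 2 := fun i => by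
    rw [Matrix.trace_vecMulVec, EuclideanSpace.real_norm_sq_eq]
    simp [dotProduct, sq]
  simp only [ridgeGram, Matrix.trace_add, Matrix.trace_smul, Matrix.trace_one, Matrix.trace_sum,
    smul_eq_mul, htrace]

lemma det_ridgeGram_le [Nonempty n] (hlam : 0 < lam) {a : ι → EuclideanSpace ℝ n}
    (ha : ∀ i, ‖a i‖ ≤ 1) :
    (ridgeGram lam a).det ≤
      (1 + Fintype.card ι / (lam * Fintype.card n)) ^ Fintype.card n * lam ^ Fintype.card n := by
  have hcard : (0 : ℝ) < Fintype.card n := by exact_mod_cast Fintype.card_pos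
  have hsum : ∑ i, ‖a i‖ ^ 2 ≤ Fintype.card ι := by
    refine (Finset.sum_le_sum fun i _ => pow_le_one₀ (norm_nonneg _) (ha i)).trans ?_
    simp
  have hM := (ridgeGram_posDef hlam a).posSemidef
  rw [← mul_pow]
  refine (det_le_trace_div_pow_card hM).trans (pow_le_pow_left₀ ?_ ?_ _)
  · exact div_nonneg hM.trace_nonneg hcard.le
  · rw [trace_ridgeGram, div_le_iff₀ hcard]
    have hexpand : (1 + Fintype.card ι / (lam * Fintype.card n)) * lam * Fintype.card n =
        lam * Fintype.card n + Fintype.card ι := by field_simp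
    linarith

lemma measurable_ridgeSolve :
    Measurable fun p : (ι → EuclideanSpace ℝ n) × EuclideanSpace ℝ n =>
      ridgeSolve lam p.1 p.2 := by
  have hgram := (continuous_ridgeGram (n := n) (ι := ι) (lam := lam)).comp
    (continuous_fst (Y := EuclideanSpace ℝ n))
  have hsolve : (fun p : (ι → EuclideanSpace ℝ n) × EuclideanSpace ℝ n =>
      ridgeSolve lam p.1 p.2) = fun p => (ridgeGram lam p.1).det⁻¹ •
        WithLp.toLp 2 (Matrix.mulVec (ridgeGram lam p.1).adjugate p.2.ofLp) := by
    funext p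
    rw [ridgeSolve, Matrix.inv_def, Ring.inverse_eq_inv', Matrix.smul_mulVec, WithLp.toLp_smul]
  rw [hsolve]
  refine hgram.matrix_det.measurable.inv.smul (Continuous.measurable ?_)
  exact (PiLp.continuous_toLp 2 _).comp (hgram.matrix_adjugate.matrix_mulVec (by fun_prop))

lemma measurable_det_ridgeGram :
    Measurable fun a : ι → EuclideanSpace ℝ n => (ridgeGram lam a).det :=
  continuous_ridgeGram.matrix_det.measurable

/-- The ridge estimation error `y = θ̂ - θ` solves `M y = S - lam • θ`, where `S` is the noise part
of the responses. -/
lemma norm_ridgeSolve_sub_lt (hlam : 0 < lam) (a : ι → EuclideanSpace ℝ n)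
    {θ S : EuclideanSpace ℝ n} (hθ : ‖θ‖ ≤ 1) {β κ : ℝ} (hβ : 0 ≤ β) (hκ : 0 < κ)
    (hS : ⟪ridgeSolve lam a S, S⟫ ≤ β ^ 2)
    (hgram : ∀ x : EuclideanSpace ℝ n, κ * ‖x‖ ^ 2 ≤ ∑ i, ⟪a i, x⟫ ^ 2) :
    ‖ridgeSolve lam a (S + ∑ i, ⟪a i, θ⟫ • a i) - θ‖ < (β + √lam) / √κ := by
  refine norm_lt_of_toEuclideanLin_eq_sub_smul (ridgeGram_posDef hlam a) hlam hκ hβ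
    (w := ridgeSolve lam a S) (fun x => ?_) ?_ hθ ?_
  · rw [inner_toEuclideanLin_ridgeGram_self, add_mul]
    exact add_le_add_right (hgram x) _
  · rwa [toEuclideanLin_ridgeGram_ridgeSolve hlam]
  · rw [map_sub, toEuclideanLin_ridgeGram_ridgeSolve hlam, toEuclideanLin_ridgeGram_ridgeSolve hlam,
      toEuclideanLin_ridgeGram]
    abel

end RidgeRegression

section SelfNormalized

variable {Ω : Type*} {m0 : MeasurableSpace Ω} {μ : Measure Ω} {n : Type*} {N : ℕ}
  {ℱ : Fin N → MeasurableSpace Ω} {a : Fin N → Ω → EuclideanSpace ℝ n} {η : Fin N → Ω → ℝ}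

/-- A sequential linear regression: given `ℱ i`, which determines the designs up to round `i` and
the noise before round `i`, the noise in round `i` is 1-sub-Gaussian. -/
structure SequentialDesign (ℱ : Fin N → MeasurableSpace Ω) (μ : Measure Ω)
    (a : Fin N → Ω → EuclideanSpace ℝ n) (η : Fin N → Ω → ℝ) : Prop where
  le : ∀ i, ℱ i ≤ m0
  measurable_design_of_le : ∀ i j, j ≤ i → Measurable[ℱ i] (a j)
  measurable_noise_of_lt : ∀ i j, j < i → Measurable[ℱ i] (η j)
  condSubGaussian : ∀ i, CondSubGaussian (ℱ i) μ (η i)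

namespace SequentialDesign

lemma measurable_design (h : SequentialDesign ℱ μ a η) (i : Fin N) : Measurable (a i) :=
  (h.measurable_design_of_le i i le_rfl).mono (h.le i) le_rfl

lemma measurable_sum_smul [Finite n] (h : SequentialDesign ℱ μ a η) :
    Measurable fun ω => ∑ i, η i ω • a i ω := by
  have := Fintype.ofFinite n
  exact Finset.measurable_sum _ fun i _ =>
    (h.condSubGaussian i).measurable.smul (h.measurable_design i)

variable [Fintype n]

lemma lintegral_prod_expWeight_inner_le_one [IsProbabilityMeasure μ]
    (h : SequentialDesign ℱ μ a η) (x : EuclideanSpace ℝ n) :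
    ∫⁻ ω, ∏ i, expWeight ⟪a i ω, x⟫ (η i ω) ∂μ ≤ 1 :=
  CondSubGaussian.lintegral_prod_expWeight_le_one h.condSubGaussian h.le h.measurable_noise_of_lt
    fun i j hij => by
      have := h.measurable_design_of_le i j hij
      fun_prop

variable [DecidableEq n] {lam : ℝ}

lemma ofReal_exp_inner_sub_ridgeGram (a : Fin N → EuclideanSpace ℝ n) (η : Fin N → ℝ)
    (x : EuclideanSpace ℝ n) :
    ENNReal.ofReal (Real.exp (⟪x, ∑ i, η i • a i⟫ -
        ⟪x, (ridgeGram lam a).toEuclideanLin x⟫ / 2)) =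
      (∏ i, expWeight ⟪a i, x⟫ (η i)) * ENNReal.ofReal (Real.exp (-(lam * ‖x‖ ^ 2 / 2))) := by
  rw [prod_expWeight, ← ENNReal.ofReal_mul (Real.exp_pos _).le, ← Real.exp_add,
    inner_toEuclideanLin_ridgeGram_self, inner_sum]
  have hsum : ∑ i, ⟪x, η i • a i⟫ = ∑ i, ⟪a i, x⟫ * η i :=
    Finset.sum_congr rfl fun i _ => by rw [inner_smul_right, real_inner_comm, mul_comm]
  rw [hsum]
  ring_nf

/-- Method of mixtures: the supermartingale bound for each direction `x` is integrated against a
Gaussian density in `x`, which turns the exponent into the self-normalized norm of the noise. -/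
lemma lintegral_exp_inner_ridgeSolve_le [IsProbabilityMeasure μ] (h : SequentialDesign ℱ μ a η)
    (hlam : 0 < lam) :
    ∫⁻ ω, ENNReal.ofReal (Real.exp (⟪ridgeSolve lam (fun i => a i ω) (∑ i, η i ω • a i ω),
        ∑ i, η i ω • a i ω⟫ / 2) * (√(ridgeGram lam fun i => a i ω).det)⁻¹) ∂μ ≤
      ENNReal.ofReal (√(lam ^ Fintype.card n))⁻¹ := by
  have ha := h.measurable_design
  have hη := fun i => (h.condSubGaussian i).measurable
  rw [← ENNReal.mul_le_mul_iff_left (gaussMass_ne_zero (n := n)) gaussMass_ne_top,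
    ← lintegral_mul_const' _ _ gaussMass_ne_top, ← lintegral_exp_neg_mul_norm_sq hlam]
  calc ∫⁻ ω, _ ∂μ = ∫⁻ ω, (∫⁻ x, (∏ i, expWeight ⟪a i ω, x⟫ (η i ω)) *
        ENNReal.ofReal (Real.exp (-(lam * ‖x‖ ^ 2 / 2)))) ∂μ := lintegral_congr fun ω => by
        have hgauss := lintegral_exp_inner_sub_of_posDef (ridgeGram_posDef hlam fun i => a i ω)
          (ridgeSolve lam (fun i => a i ω) (∑ i, η i ω • a i ω))
        rw [toEuclideanLin_ridgeGram_ridgeSolve hlam] at hgauss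
        rw [← hgauss]
        exact lintegral_congr fun x => ofReal_exp_inner_sub_ridgeGram _ _ x
    _ = ∫⁻ x, (∫⁻ ω, ∏ i, expWeight ⟪a i ω, x⟫ (η i ω) ∂μ) *
        ENNReal.ofReal (Real.exp (-(lam * ‖x‖ ^ 2 / 2))) := by
        rw [lintegral_lintegral_swap (by fun_prop)]
        exact lintegral_congr fun x => lintegral_mul_const' _ _ ENNReal.ofReal_ne_top
    _ ≤ ∫⁻ x : EuclideanSpace ℝ n, ENNReal.ofReal (Real.exp (-(lam * ‖x‖ ^ 2 / 2))) :=
        lintegral_mono fun x => mul_le_of_le_one_left' (h.lintegral_prod_expWeight_inner_le_one x)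

/-- On the tail event the determinant is controlled by the trace, so the exponential of the
self-normalized norm is large there. -/
lemma le_exp_mul_inv_sqrt_det [Nonempty n] (hlam : 0 < lam) {a : Fin N → EuclideanSpace ℝ n}
    (ha : ∀ i, ‖a i‖ ≤ 1) {ε q : ℝ} (hε : 0 < ε)
    (hq : Fintype.card n * Real.log (1 + N / (lam * Fintype.card n)) + 2 * Real.log (1 / ε) ≤ q) :
    1 / ε * (√(lam ^ Fintype.card n))⁻¹ ≤ Real.exp (q / 2) * (√(ridgeGram lam a).det)⁻¹ := by
  set k := Fintype.card n
  set r : ℝ := 1 + N / (lam * k)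
  have hr0 : 0 < r := by positivity
  have hdet := (ridgeGram_posDef hlam a).det_pos
  have hdet_le : √(ridgeGram lam a).det ≤ √(r ^ k) * √(lam ^ k) := by
    rw [← Real.sqrt_mul (by positivity)]
    simpa only [Fintype.card_fin] using Real.sqrt_le_sqrt (det_ridgeGram_le hlam ha)
  have hexp : 1 / ε * √(r ^ k) ≤ Real.exp (q / 2) := by
    calc 1 / ε * √(r ^ k) = Real.exp ((k * Real.log r + 2 * Real.log (1 / ε)) / 2) := by
          rw [add_div, mul_div_cancel_left₀ _ two_ne_zero, Real.exp_add,
            Real.exp_log (by positivity), Real.exp_half, ← Real.log_pow,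
            Real.exp_log (by positivity), mul_comm]
      _ ≤ Real.exp (q / 2) := by gcongr
  calc 1 / ε * (√(lam ^ k))⁻¹ = 1 / ε * √(r ^ k) * (√(r ^ k) * √(lam ^ k))⁻¹ := by
        field_simp
    _ ≤ _ := by gcongr

lemma measure_lt_inner_ridgeSolve_le [IsProbabilityMeasure μ] [Nonempty n]
    (h : SequentialDesign ℱ μ a η) (hlam : 0 < lam) (hnorm : ∀ᵐ ω ∂μ, ∀ i, ‖a i ω‖ ≤ 1)
    {ε : ℝ} (hε : 0 < ε) :
    μ {ω | Fintype.card n * Real.log (1 + N / (lam * Fintype.card n)) + 2 * Real.log (1 / ε) <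
      ⟪ridgeSolve lam (fun i => a i ω) (∑ i, η i ω • a i ω), ∑ i, η i ω • a i ω⟫} ≤
      ENNReal.ofReal ε := by
  set Y : Ω → ENNReal := fun ω => ENNReal.ofReal (Real.exp (⟪ridgeSolve lam (fun i => a i ω)
    (∑ i, η i ω • a i ω), ∑ i, η i ω • a i ω⟫ / 2) * (√(ridgeGram lam fun i => a i ω).det)⁻¹)
  set c : ENNReal := ENNReal.ofReal (1 / ε * (√(lam ^ Fintype.card n))⁻¹)
  have hYm : Measurable Y := by
    have ham : Measurable fun ω i => a i ω := measurable_pi_lambda _ h.measurable_design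
    have hsum := h.measurable_sum_smul
    have hsolve := (measurable_ridgeSolve (lam := lam)).comp (ham.prodMk hsum)
    have hdet := (measurable_det_ridgeGram (lam := lam)).comp ham
    exact ((((hsolve.inner hsum).div_const 2).exp).mul hdet.sqrt.inv).ennreal_ofReal
  have hc : c ≠ 0 := (ENNReal.ofReal_pos.2 (by positivity)).ne'
  calc _ ≤ μ {ω | c ≤ Y ω} := measure_mono_ae <| by
        filter_upwards [hnorm] with ω hω hlt
        exact ENNReal.ofReal_le_ofReal
          (le_exp_mul_inv_sqrt_det hlam hω hε (le_of_lt hlt))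
    _ ≤ (∫⁻ ω, Y ω ∂μ) / c :=
        meas_ge_le_lintegral_div hYm.aemeasurable hc ENNReal.ofReal_ne_top
    _ ≤ ENNReal.ofReal ε := by
        rw [ENNReal.div_le_iff hc ENNReal.ofReal_ne_top, ← ENNReal.ofReal_mul hε.le, ← mul_assoc,
          mul_one_div_cancel hε.ne', one_mul]
        exact h.lintegral_exp_inner_ridgeSolve_le hlam

end SequentialDesign

end SelfNormalized

section ActionLaw

variable {d : ℕ} {ρ : Measure (Vec d)} {lamA σ : ℝ}

/-- The part of `RegularLaw` that concerns lower bounds: a distribution on the unit ball with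
`E ⟪x, a⟫² ≥ lamA > 0` for every unit vector `x`, whose squared projections `⟪x, a⟫²` have
sub-Gaussian lower tails with variance proxy `σ²`. -/
structure LowerRegularLaw (ρ : Measure (Vec d)) (lamA σ : ℝ) : Prop where
  isProbability : IsProbabilityMeasure ρ
  norm_le_one : ∀ᵐ a ∂ρ, ‖a‖ ≤ 1
  lamA_pos : 0 < lamA
  sigma_pos : 0 < σ
  le_integral_inner_sq : ∀ x : Vec d, ‖x‖ = 1 → lamA ≤ ∫ b, ⟪x, b⟫ ^ 2 ∂ρ
  lower_tail : ∀ x : Vec d, ‖x‖ = 1 → ∀ t : ℝ, 0 ≤ t →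
    ρ.real {a | ⟪x, a⟫ ^ 2 ≤ (∫ b, ⟪x, b⟫ ^ 2 ∂ρ) - t} ≤ Real.exp (-t ^ 2 / (2 * σ ^ 2))

lemma integrable_coord_mul [IsFiniteMeasure ρ] (hρ : ∀ᵐ a ∂ρ, ‖a‖ ≤ 1) (i j : Fin d) :
    Integrable (fun a : Vec d => a i * a j) ρ := by
  refine Integrable.of_bound (by fun_prop) 1 ?_
  filter_upwards [hρ] with a ha
  rw [norm_mul]
  exact mul_le_one₀ ((PiLp.norm_apply_le a i).trans ha) (norm_nonneg _)
    ((PiLp.norm_apply_le a j).trans ha)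

lemma integral_inner_sq [IsFiniteMeasure ρ] (hρ : ∀ᵐ a ∂ρ, ‖a‖ ≤ 1) (x : Vec d) :
    ∫ b, ⟪x, b⟫ ^ 2 ∂ρ = x.ofLp ⬝ᵥ (secondMoment ρ).mulVec x.ofLp := by
  have hint := integrable_coord_mul hρ
  have hexpand : ∀ b : Vec d, ⟪x, b⟫ ^ 2 = ∑ i, ∑ j, x i * x j * (b i * b j) := fun b => by
    rw [sq, PiLp.inner_apply, Finset.sum_mul_sum]
    refine Finset.sum_congr rfl fun i _ => Finset.sum_congr rfl fun j _ => ?_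
    simp only [Real.inner_apply]
    ring
  simp_rw [hexpand]
  rw [integral_finsetSum _ fun i _ => integrable_finsetSum _ fun j _ => (hint i j).const_mul _]
  refine Finset.sum_congr rfl fun i _ => ?_
  rw [integral_finsetSum _ fun j _ => (hint i j).const_mul _, Matrix.mulVec, dotProduct,
    Finset.mul_sum]
  refine Finset.sum_congr rfl fun j _ => ?_
  rw [integral_const_mul, secondMoment, Matrix.of_apply]
  ring

lemma RegularLaw.dim_pos (hρ : RegularLaw ρ lamA σ) : 0 < d := by
  refine Nat.pos_of_ne_zero ?_
  rintro rfl
  have hmem := hρ.isLeast_eigenvalue.1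
  rw [spectrum.of_subsingleton] at hmem
  exact hmem

lemma posSemidef_sub_smul_one {n : Type*} [Fintype n] [DecidableEq n] {A : Matrix n n ℝ}
    (hA : A.IsHermitian) {c : ℝ} (hc : c ∈ lowerBounds (spectrum ℝ A)) :
    (A - c • (1 : Matrix n n ℝ)).PosSemidef := by
  rw [Matrix.posSemidef_iff_isHermitian_and_spectrum_nonneg]
  refine ⟨hA.sub (by simp [Matrix.IsHermitian]), fun t ht => ?_⟩
  rw [← Algebra.algebraMap_eq_smul_one, ← spectrum.sub_singleton_eq] at ht
  obtain ⟨s, hs, r, rfl, rfl⟩ := ht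
  exact sub_nonneg.2 (hc hs)

lemma RegularLaw.toLowerRegularLaw (hρ : RegularLaw ρ lamA σ) : LowerRegularLaw ρ lamA σ where
  isProbability := hρ.isProbability
  norm_le_one := hρ.norm_le_one
  lamA_pos := hρ.lamA_pos
  sigma_pos := hρ.sigma_pos
  le_integral_inner_sq x hx := by
    have := hρ.isProbability
    have hherm : (secondMoment ρ).IsHermitian := by
      ext i j
      simp [secondMoment, mul_comm]
    have hquad := (posSemidef_sub_smul_one hherm
      hρ.isLeast_eigenvalue.2).dotProduct_mulVec_nonneg x.ofLp
    have hnorm : x.ofLp ⬝ᵥ x.ofLp = 1 := by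
      rw [← one_pow 2, ← hx, EuclideanSpace.real_norm_sq_eq]
      simp [dotProduct, sq]
    rwa [star_trivial, Matrix.sub_mulVec, dotProduct_sub, Matrix.smul_mulVec, Matrix.one_mulVec,
      dotProduct_smul, hnorm, smul_eq_mul, mul_one, sub_nonneg,
      ← integral_inner_sq hρ.norm_le_one] at hquad
  lower_tail := hρ.lower_tail

lemma inner_sq_le_one {E : Type*} [NormedAddCommGroup E] [InnerProductSpace ℝ E] {x a : E}
    (hx : ‖x‖ ≤ 1) (ha : ‖a‖ ≤ 1) : ⟪x, a⟫ ^ 2 ≤ 1 := by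
  rw [← sq_abs]
  exact pow_le_one₀ (abs_nonneg _)
    ((abs_real_inner_le_norm x a).trans (mul_le_one₀ hx (norm_nonneg a) ha))

lemma LowerRegularLaw.lamA_mul_dim_le_one (hρ : LowerRegularLaw ρ lamA σ) : lamA * d ≤ 1 := by
  have := hρ.isProbability
  set e := EuclideanSpace.basisFun (Fin d) ℝ
  have hint : ∀ i, Integrable (fun b => ⟪e i, b⟫ ^ 2) ρ := fun i => by
    refine Integrable.of_bound (by fun_prop) 1 ?_
    filter_upwards [hρ.norm_le_one] with b hb
    rw [Real.norm_of_nonneg (sq_nonneg _)]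
    exact inner_sq_le_one (e.norm_eq_one i).le hb
  calc lamA * d = ∑ _i : Fin d, lamA := by simp [mul_comm]
    _ ≤ ∑ i, ∫ b, ⟪e i, b⟫ ^ 2 ∂ρ :=
        Finset.sum_le_sum fun i _ => hρ.le_integral_inner_sq (e i) (e.norm_eq_one i)
    _ = ∫ b, ‖b‖ ^ 2 ∂ρ := by
        rw [← integral_finsetSum _ fun i _ => hint i]
        simp_rw [e.sum_sq_inner_right]
    _ ≤ ∫ _b, (1 : ℝ) ∂ρ := by
        refine integral_mono_of_nonneg (ae_of_all _ fun b => sq_nonneg _) (integrable_const _) ?_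
        filter_upwards [hρ.norm_le_one] with b hb using pow_le_one₀ (norm_nonneg b) hb
    _ = 1 := by simp

lemma LowerRegularLaw.one_sub_exp_le_measureReal (hρ : LowerRegularLaw ρ lamA σ) {x : Vec d}
    (hx : ‖x‖ = 1) {t : ℝ} (ht : t ≤ lamA) :
    1 - Real.exp (-(lamA - t) ^ 2 / (2 * σ ^ 2)) ≤ ρ.real {a | t ≤ ⟪x, a⟫ ^ 2} := by
  have := hρ.isProbability
  have hσ := hρ.sigma_pos
  have hmean := hρ.le_integral_inner_sq x hx
  have htail : ρ.real {a | ⟪x, a⟫ ^ 2 ≤ t} ≤ Real.exp (-(lamA - t) ^ 2 / (2 * σ ^ 2)) := by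
    have htail_mean := hρ.lower_tail x hx ((∫ b, ⟪x, b⟫ ^ 2 ∂ρ) - t) (by linarith)
    rw [sub_sub_cancel] at htail_mean
    refine htail_mean.trans (Real.exp_le_exp.2 ?_)
    gcongr
  have hcompl : 1 - ρ.real {a | ⟪x, a⟫ ^ 2 ≤ t} ≤ ρ.real {a | t ≤ ⟪x, a⟫ ^ 2} := by
    rw [← probReal_compl_eq_one_sub (measurableSet_le (by fun_prop) measurable_const)]
    exact measureReal_mono fun a (ha : ¬⟪x, a⟫ ^ 2 ≤ t) => (not_le.1 ha).le
  linarith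

end ActionLaw

section SmoothedRegularity

variable {lamA σ : ℝ}

lemma one_sub_exp_neg_sq_mem_Icc (lamA σ x : ℝ) :
    1 - Real.exp (-(lamA - x) ^ 2 / (2 * σ ^ 2)) ∈ Icc (0 : ℝ) 1 := by
  have hexp : Real.exp (-(lamA - x) ^ 2 / (2 * σ ^ 2)) ≤ 1 := by
    rw [Real.exp_le_one_iff]
    exact div_nonpos_of_nonpos_of_nonneg (neg_nonpos.2 (sq_nonneg _)) (by positivity)
  exact ⟨sub_nonneg.2 hexp, sub_le_self _ (Real.exp_pos _).le⟩

lemma continuous_one_sub_exp_neg_sq_pow (lamA σ : ℝ) (S : ℕ) :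
    Continuous fun x : ℝ => (1 - Real.exp (-(lamA - x) ^ 2 / (2 * σ ^ 2))) ^ S := by
  fun_prop

lemma smoothedRegularity_pos (hlamA : 0 < lamA) (hσ : 0 < σ) (S : ℕ) :
    0 < smoothedRegularity lamA σ S := by
  refine intervalIntegral.intervalIntegral_pos_of_pos_on
    ((continuous_one_sub_exp_neg_sq_pow lamA σ S).intervalIntegrable _ _) (fun x hx => ?_) hlamA
  refine pow_pos (sub_pos.2 (Real.exp_lt_one_iff.2 ?_)) _
  exact div_neg_of_neg_of_pos (neg_neg_of_pos (pow_pos (sub_pos.2 hx.2) 2)) (by positivity)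

lemma smoothedRegularity_le (hlamA : 0 ≤ lamA) (S : ℕ) : smoothedRegularity lamA σ S ≤ lamA := by
  calc smoothedRegularity lamA σ S ≤ ∫ _x in (0 : ℝ)..lamA, (1 : ℝ) :=
        intervalIntegral.integral_mono_on hlamA
          ((continuous_one_sub_exp_neg_sq_pow lamA σ S).intervalIntegrable _ _) (by simp)
          fun x _ => pow_le_one₀ (one_sub_exp_neg_sq_mem_Icc lamA σ x).1
            (one_sub_exp_neg_sq_mem_Icc lamA σ x).2
    _ = lamA := by simp

lemma LowerRegularLaw.mul_dim_le_one {d S : ℕ} {ρ : Measure (Vec d)} {p : ℝ}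
    (hρ : LowerRegularLaw ρ lamA σ) (hp : p ≤ smoothedRegularity lamA σ S) :
    p * d ≤ 1 :=
  (mul_le_mul_of_nonneg_right (hp.trans (smoothedRegularity_le hρ.lamA_pos.le S))
    (Nat.cast_nonneg d)).trans hρ.lamA_mul_dim_le_one

lemma ofReal_smoothedRegularity (hlamA : 0 ≤ lamA) (S : ℕ) :
    ENNReal.ofReal (smoothedRegularity lamA σ S) =
      ∫⁻ t in Ioc 0 lamA, ENNReal.ofReal (1 - Real.exp (-(lamA - t) ^ 2 / (2 * σ ^ 2))) ^ S := by
  rw [smoothedRegularity, intervalIntegral.integral_of_le hlamA,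
    ofReal_integral_eq_lintegral_ofReal
      (continuous_one_sub_exp_neg_sq_pow lamA σ S).integrableOn_Ioc
      (ae_of_all _ fun t => pow_nonneg (one_sub_exp_neg_sq_mem_Icc lamA σ t).1 S)]
  simp_rw [ENNReal.ofReal_pow (one_sub_exp_neg_sq_mem_Icc lamA σ _).1]

end SmoothedRegularity

section WorstCandidate

variable {Ω κ : Type*} [MeasurableSpace Ω] {μ : Measure Ω} [Nonempty κ] {d : ℕ}
  {ρ : Measure (Vec d)} {lamA σ : ℝ}

lemma ae_iInf_inner_sq_mem_Icc [Finite κ] (hρ : ∀ᵐ a ∂ρ, ‖a‖ ≤ 1) {c : κ → Ω → Vec d}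
    (hc : ∀ k, Measurable (c k)) (hlaw : ∀ k, μ.map (c k) = ρ) {x : Vec d} (hx : ‖x‖ = 1) :
    ∀ᵐ ω ∂μ, ⨅ k, ⟪x, c k ω⟫ ^ 2 ∈ Icc (0 : ℝ) 1 := by
  obtain ⟨k⟩ := ‹Nonempty κ›
  rw [← hlaw k] at hρ
  filter_upwards [ae_of_ae_map (hc k).aemeasurable hρ] with ω hω
  exact ⟨Real.iInf_nonneg fun _ => sq_nonneg _,
    (ciInf_le (finite_range _).bddBelow k).trans (inner_sq_le_one hx.le hω)⟩

variable [Fintype κ]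

lemma measure_le_iInf_eq_prod {Y : κ → Ω → ℝ} (hind : iIndepFun Y μ) (t : ℝ) :
    μ {ω | t ≤ ⨅ k, Y k ω} = ∏ k, μ {ω | t ≤ Y k ω} := by
  have hset : {ω | t ≤ ⨅ k, Y k ω} = ⋂ k, {ω | t ≤ Y k ω} := by
    ext ω
    simp only [mem_ofPred_eq, mem_iInter]
    exact le_ciInf_iff (finite_range _).bddBelow
  rw [hset]
  exact hind.meas_iInter fun k => ⟨Ici t, measurableSet_Ici, rfl⟩

lemma setLIntegral_pow_card_le_lintegral_iInf {Y : κ → Ω → ℝ} (hY : ∀ k, Measurable (Y k))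
    (hY0 : ∀ k ω, 0 ≤ Y k ω) (hind : iIndepFun Y μ) {s : Set ℝ} (hs : MeasurableSet s)
    (hs0 : s ⊆ Ioi 0) {g : ℝ → ENNReal} (hg : ∀ t ∈ s, ∀ k, g t ≤ μ {ω | t ≤ Y k ω}) :
    ∫⁻ t in s, g t ^ Fintype.card κ ≤ ∫⁻ ω, ENNReal.ofReal (⨅ k, Y k ω) ∂μ := by
  rw [lintegral_eq_lintegral_meas_le μ (ae_of_all _ fun ω => Real.iInf_nonneg fun k => hY0 k ω)
    (Measurable.iInf hY).aemeasurable]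
  refine (setLIntegral_mono' hs fun t ht => ?_).trans (lintegral_mono_set hs0)
  rw [measure_le_iInf_eq_prod hind]
  calc g t ^ Fintype.card κ = ∏ _k : κ, g t := by simp
    _ ≤ ∏ k, μ {ω | t ≤ Y k ω} := Finset.prod_le_prod' fun k _ => hg t ht k

lemma smoothedRegularity_le_integral_iInf [IsFiniteMeasure μ] (hρ : LowerRegularLaw ρ lamA σ)
    {S : ℕ} (hκ : Fintype.card κ ≤ S) {c : κ → Ω → Vec d} (hc : ∀ k, Measurable (c k))
    (hind : iIndepFun c μ) (hlaw : ∀ k, μ.map (c k) = ρ) {x : Vec d} (hx : ‖x‖ = 1) :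
    smoothedRegularity lamA σ S ≤ ∫ ω, ⨅ k, ⟪x, c k ω⟫ ^ 2 ∂μ := by
  have hproj : Measurable fun a : Vec d => ⟪x, a⟫ ^ 2 := by fun_prop
  have hY : ∀ k, Measurable fun ω => ⟪x, c k ω⟫ ^ 2 := fun k => hproj.comp (hc k)
  have hmin_nonneg : ∀ ω, 0 ≤ ⨅ k, ⟪x, c k ω⟫ ^ 2 :=
    fun ω => Real.iInf_nonneg fun k => sq_nonneg _
  have hmin : Integrable (fun ω => ⨅ k, ⟪x, c k ω⟫ ^ 2) μ :=
    Integrable.of_mem_Icc 0 1 (Measurable.iInf hY).aemeasurable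
      (ae_iInf_inner_sq_mem_Icc hρ.norm_le_one hc hlaw hx)
  have htail : ∀ t ∈ Ioc 0 lamA, ∀ k,
      ENNReal.ofReal (1 - Real.exp (-(lamA - t) ^ 2 / (2 * σ ^ 2))) ≤
        μ {ω | t ≤ ⟪x, c k ω⟫ ^ 2} := fun t ht k => by
    have := hρ.isProbability
    change _ ≤ μ (c k ⁻¹' {a | t ≤ ⟪x, a⟫ ^ 2})
    rw [← Measure.map_apply (hc k) (measurableSet_le measurable_const hproj), hlaw k]
    exact ENNReal.ofReal_le_of_le_toReal (hρ.one_sub_exp_le_measureReal hx ht.2)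
  rw [← ENNReal.ofReal_le_ofReal_iff (integral_nonneg hmin_nonneg),
    ofReal_integral_eq_lintegral_ofReal hmin (ae_of_all _ hmin_nonneg),
    ofReal_smoothedRegularity hρ.lamA_pos.le]
  calc ∫⁻ t in Ioc 0 lamA, ENNReal.ofReal (1 - Real.exp (-(lamA - t) ^ 2 / (2 * σ ^ 2))) ^ S
      ≤ ∫⁻ t in Ioc 0 lamA,
          ENNReal.ofReal (1 - Real.exp (-(lamA - t) ^ 2 / (2 * σ ^ 2))) ^ Fintype.card κ :=
        lintegral_mono fun t => pow_le_pow_right_of_le_one'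
          (ENNReal.ofReal_le_one.2 (one_sub_exp_neg_sq_mem_Icc lamA σ t).2) hκ
    _ ≤ ∫⁻ ω, ENNReal.ofReal (⨅ k, ⟪x, c k ω⟫ ^ 2) ∂μ :=
        setLIntegral_pow_card_le_lintegral_iInf hY (fun k ω => sq_nonneg _)
          (hind.comp (fun _ a => ⟪x, a⟫ ^ 2) fun _ => hproj) measurableSet_Ioc
          Ioc_subset_Ioi_self htail

end WorstCandidate

section LowerTail

variable {Ω ι : Type*} [MeasurableSpace Ω] {μ : Measure Ω}

lemma iIndepFun_curry {κ : ι → Type*} {E : (i : ι) → κ i → Type*}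
    [∀ i k, MeasurableSpace (E i k)] {X : (i : ι) → (k : κ i) → Ω → E i k}
    (hX : ∀ i k, Measurable (X i k))
    (hind : iIndepFun (fun (p : (i : ι) × κ i) ω => X p.1 p.2 ω) μ) :
    iIndepFun (fun i ω k => X i k ω) μ := by
  have := hind.isProbabilityMeasure
  have hmap : ∀ i k, IsProbabilityMeasure (μ.map (X i k)) :=
    fun i k => Measure.isProbabilityMeasure_map (hX i k).aemeasurable
  have hblock : ∀ i, μ.map (fun ω k => X i k ω) = Measure.infinitePi fun k => μ.map (X i k) :=
    fun i => (hind.precomp (g := Sigma.mk i) sigma_mk_injective).map_fun_eq_infinitePi_map (hX i)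
  have hcurry : (fun ω i k => X i k ω) =
      MeasurableEquiv.piCurry E ∘ fun ω (p : (i : ι) × κ i) => X p.1 p.2 ω := by
    ext
    simp [Sigma.curry]
  rw [iIndepFun_iff_map_fun_eq_infinitePi_map (by fun_prop), hcurry,
    ← Measure.map_map (by fun_prop) (by fun_prop),
    hind.map_fun_eq_infinitePi_map fun p => hX p.1 p.2,
    Measure.infinitePi_map_piCurry fun i k => μ.map (X i k)]
  simp_rw [hblock]

lemma exp_neg_le_one_sub_add_sq_div_two {x : ℝ} (hx : 0 ≤ x) :
    Real.exp (-x) ≤ 1 - x + x ^ 2 / 2 := by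
  have hquad : 0 ≤ 1 - x + x ^ 2 / 2 := by nlinarith [sq_nonneg (x - 1)]
  rw [Real.exp_neg, inv_le_iff_one_le_mul₀ (Real.exp_pos x)]
  calc (1 : ℝ) ≤ (1 - x + x ^ 2 / 2) * (1 + x + x ^ 2 / 2) := by nlinarith [sq_nonneg (x ^ 2)]
    _ ≤ (1 - x + x ^ 2 / 2) * Real.exp x :=
        mul_le_mul_of_nonneg_left (Real.quadratic_le_exp_of_nonneg hx) hquad

lemma exp_neg_mul_le_one_sub_mul {s y : ℝ} (hs : 0 ≤ s) (hy : y ∈ Icc (0 : ℝ) 1) :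
    Real.exp (-s * y) ≤ 1 - (s - s ^ 2 / 2) * y := by
  have hexp := exp_neg_le_one_sub_add_sq_div_two (mul_nonneg hs hy.1)
  have hsq : y ^ 2 ≤ y := by nlinarith [hy.1, hy.2]
  rw [neg_mul]
  nlinarith [mul_le_mul_of_nonneg_left hsq (sq_nonneg s)]

lemma mgf_neg_le_exp [IsProbabilityMeasure μ] {Z : Ω → ℝ} (hZ : AEMeasurable Z μ)
    (hZ01 : ∀ᵐ ω ∂μ, Z ω ∈ Icc (0 : ℝ) 1) {p s : ℝ} (hp : p ≤ ∫ ω, Z ω ∂μ)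
    (hs0 : 0 ≤ s) (hs1 : s ≤ 1) :
    mgf Z μ (-s) ≤ Real.exp (-((s - s ^ 2 / 2) * p)) := by
  have hs : 0 ≤ s - s ^ 2 / 2 := by nlinarith
  have hint : Integrable Z μ := .of_mem_Icc 0 1 hZ hZ01
  calc mgf Z μ (-s) ≤ ∫ ω, (1 - (s - s ^ 2 / 2) * Z ω) ∂μ := by
        refine integral_mono_of_nonneg (ae_of_all _ fun ω => (Real.exp_pos _).le)
          ((integrable_const _).sub (hint.const_mul _)) ?_
        filter_upwards [hZ01] with ω hω using exp_neg_mul_le_one_sub_mul hs0 hω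
    _ = 1 - (s - s ^ 2 / 2) * ∫ ω, Z ω ∂μ := by
        rw [integral_sub (integrable_const _) (hint.const_mul _), integral_const_mul]
        simp
    _ ≤ 1 - (s - s ^ 2 / 2) * p := sub_le_sub_left (mul_le_mul_of_nonneg_left hp hs) 1
    _ ≤ Real.exp (-((s - s ^ 2 / 2) * p)) := Real.one_sub_le_exp_neg _

lemma measureReal_sum_le_le_exp [Fintype ι] {Z : ι → Ω → ℝ} (hZ : ∀ i, Measurable (Z i))
    (hind : iIndepFun Z μ) (hZ01 : ∀ i, ∀ᵐ ω ∂μ, Z i ω ∈ Icc (0 : ℝ) 1) {p s : ℝ}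
    (hp : ∀ i, p ≤ ∫ ω, Z i ω ∂μ) (hs0 : 0 ≤ s) (hs1 : s ≤ 1) :
    μ.real {ω | ∑ i, Z i ω ≤ (1 - s) * (Fintype.card ι * p)} ≤
      Real.exp (-(s ^ 2 / 2 * (Fintype.card ι * p))) := by
  have := hind.isProbabilityMeasure
  have hnonneg : ∀ᵐ ω ∂μ, 0 ≤ ∑ i, Z i ω := by
    filter_upwards [ae_all_iff.2 hZ01] with ω hω using Finset.sum_nonneg fun i _ => (hω i).1
  have hint : Integrable (fun ω => Real.exp (-s * ∑ i, Z i ω)) μ := by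
    refine Integrable.of_bound (by fun_prop) 1 ?_
    filter_upwards [hnonneg] with ω hω
    rw [Real.norm_of_nonneg (Real.exp_pos _).le, Real.exp_le_one_iff, neg_mul]
    exact neg_nonpos.2 (mul_nonneg hs0 hω)
  have hmgf : mgf (fun ω => ∑ i, Z i ω) μ (-s) ≤
      Real.exp (-((s - s ^ 2 / 2) * (Fintype.card ι * p))) := by
    have hsum : (fun ω => ∑ i, Z i ω) = ∑ i, Z i := by
      ext ω
      simp
    rw [hsum, hind.mgf_sum hZ]
    calc ∏ i, mgf (Z i) μ (-s) ≤ ∏ _i : ι, Real.exp (-((s - s ^ 2 / 2) * p)) :=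
          Finset.prod_le_prod (fun i _ => mgf_nonneg) fun i _ =>
            mgf_neg_le_exp (hZ i).aemeasurable (hZ01 i) (hp i) hs0 hs1
      _ = Real.exp (-((s - s ^ 2 / 2) * (Fintype.card ι * p))) := by
          rw [Finset.prod_const, ← Real.exp_nat_mul, Finset.card_univ]
          ring_nf
  calc μ.real {ω | ∑ i, Z i ω ≤ (1 - s) * (Fintype.card ι * p)}
      ≤ Real.exp (- -s * ((1 - s) * (Fintype.card ι * p))) *
          mgf (fun ω => ∑ i, Z i ω) μ (-s) :=
        measure_le_le_exp_mul_mgf _ (neg_nonpos.2 hs0) hint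
    _ ≤ Real.exp (- -s * ((1 - s) * (Fintype.card ι * p))) *
          Real.exp (-((s - s ^ 2 / 2) * (Fintype.card ι * p))) :=
        mul_le_mul_of_nonneg_left hmgf (Real.exp_pos _).le
    _ = Real.exp (-(s ^ 2 / 2 * (Fintype.card ι * p))) := by
        rw [← Real.exp_add]
        ring_nf

end LowerTail

section SelectedActions

variable {Ω : Type*} [MeasurableSpace Ω] {μ : Measure Ω} {U d S : ℕ} {D : Dataset Ω U d}
  {ρ : Measure (Vec d)} {lamA σ : ℝ}

lemma SelectedFromCandidates.ae_norm_action_le_one (hsel : SelectedFromCandidates μ D ρ S)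
    (hρ : ∀ᵐ a ∂ρ, ‖a‖ ≤ 1) (u : Fin U) : ∀ᵐ ω ∂μ, ∀ i, ‖D.action u i ω‖ ≤ 1 := by
  obtain ⟨K, c, -, hc, -, hlaw, hact⟩ := hsel u
  have hcand : ∀ᵐ ω ∂μ, ∀ i k, ‖c i k ω‖ ≤ 1 :=
    ae_all_iff.2 fun i => ae_all_iff.2 fun k =>
      ae_of_ae_map (hc i k).aemeasurable (by rwa [hlaw i k])
  filter_upwards [hcand, ae_all_iff.2 hact] with ω hω hsome i
  obtain ⟨k, hk⟩ := hsome i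
  rw [hk]
  exact hω i k

-- Whatever the selection rule, `⟪x, aᵢ⟫²` is at least the minimum over the candidates of
-- round `i`, and these minima are independent across rounds.
lemma SelectedFromCandidates.measureReal_sum_inner_sq_le (hsel : SelectedFromCandidates μ D ρ S)
    (hρ : LowerRegularLaw ρ lamA σ) (u : Fin U) {x : Vec d} (hx : ‖x‖ = 1) {p s : ℝ}
    (hp : p ≤ smoothedRegularity lamA σ S) (hs0 : 0 ≤ s) (hs1 : s ≤ 1) :
    μ.real {ω | ∑ i, ⟪x, D.action u i ω⟫ ^ 2 ≤ (1 - s) * (D.N u * p)} ≤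
      Real.exp (-(s ^ 2 / 2 * (D.N u * p))) := by
  obtain ⟨K, c, hKS, hc, hind, hlaw, hact⟩ := hsel u
  have := hind.isProbabilityMeasure
  have hne : ∀ i, Nonempty (Fin (K i)) := fun i => by
    obtain ⟨ω, k, -⟩ := (hact i).exists
    exact ⟨k⟩
  have hmin : ∀ i, Measurable fun v : Fin (K i) → Vec d => ⨅ k, ⟪x, v k⟫ ^ 2 :=
    fun i => Measurable.iInf fun k => by fun_prop
  have hchernoff := measureReal_sum_le_le_exp (Z := fun i ω => ⨅ k, ⟪x, c i k ω⟫ ^ 2)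
    (fun i => (hmin i).comp (measurable_pi_lambda _ (hc i)))
    ((iIndepFun_curry hc hind).comp _ hmin)
    (fun i => ae_iInf_inner_sq_mem_Icc hρ.norm_le_one (hc i) (hlaw i) hx)
    (fun i => hp.trans (smoothedRegularity_le_integral_iInf hρ (by simpa using hKS i) (hc i)
      (hind.precomp (g := Sigma.mk i) sigma_mk_injective) (hlaw i) hx)) hs0 hs1
  rw [Fintype.card_fin] at hchernoff
  refine (ENNReal.toReal_mono (measure_ne_top μ _) (measure_mono_ae ?_)).trans hchernoff
  filter_upwards [ae_all_iff.2 hact] with ω hω hsum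
  refine (Finset.sum_le_sum fun i _ => ?_).trans hsum
  obtain ⟨k, hk⟩ := hω i
  rw [hk]
  exact ciInf_le (f := fun k => ⟪x, c i k ω⟫ ^ 2) (finite_range _).bddBelow k

end SelectedActions

section SphereNet

open Metric Module
open scoped NNReal

lemma packingNumber_ne_top {X : Type*} [PseudoEMetricSpace X] {ε : ℝ≥0} (hε : ε ≠ 0) {s : Set X}
    (hs : IsCompact s) : packingNumber ε s ≠ ⊤ := by
  obtain ⟨N, -, hN, hcover⟩ := exists_finite_isCover_of_isCompact (half_pos hε.bot_lt).ne' hs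
  refine ne_top_of_le_ne_top hN.encard_lt_top.ne ?_
  calc packingNumber ε s = packingNumber (2 * (ε / 2)) s := by rw [mul_div_cancel₀ _ two_ne_zero]
    _ ≤ externalCoveringNumber (ε / 2) s := packingNumber_two_mul_le_externalCoveringNumber _ _
    _ ≤ N.encard := hcover.externalCoveringNumber_le_encard

variable {E : Type*} [NormedAddCommGroup E] [NormedSpace ℝ E] [FiniteDimensional ℝ E]

-- The balls of radius `r` around the points lie in the annulus `1 - r < ‖x‖ < 1 + r`, whose volume
-- is of order `r`; this saves a factor `1 / r` over packing the balls into the unit ball.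
lemma card_mul_pow_le_of_pairwise_disjoint_ball {s : Finset E} {r : ℝ} (hr0 : 0 < r) (hr1 : r ≤ 1)
    (hs : ∀ c ∈ s, ‖c‖ = 1) (hdisj : (s : Set E).PairwiseDisjoint (ball · r)) :
    s.card * r ^ finrank ℝ E ≤ (1 + r) ^ finrank ℝ E - (1 - r) ^ finrank ℝ E := by
  borelize E
  set μ : Measure E := Measure.addHaar
  have hunit : 0 < μ.real (ball 0 1) :=
    ENNReal.toReal_pos (measure_ball_pos μ 0 one_pos).ne' measure_ball_lt_top.ne
  have hvol : ∀ (x : E) {t : ℝ}, 0 < t →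
      μ.real (ball x t) = t ^ finrank ℝ E * μ.real (ball 0 1) := fun x t ht => by
    rw [Measure.real, Measure.addHaar_ball_of_pos μ x ht, ENNReal.toReal_mul,
      ENNReal.toReal_ofReal (by positivity), Measure.real]
  have hcore : Disjoint (⋃ c ∈ s, ball c r) (closedBall 0 (1 - r)) := by
    refine disjoint_iUnion₂_left.2 fun c hc => ball_disjoint_closedBall ?_
    rw [dist_zero_right, hs c hc, add_sub_cancel]
  have hsub : (⋃ c ∈ s, ball c r) ∪ closedBall 0 (1 - r) ⊆ ball 0 (1 + r) := by
    refine union_subset (iUnion₂_subset fun c hc => ball_subset_ball' ?_)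
      (closedBall_subset_ball (by linarith))
    rw [dist_zero_right, hs c hc, add_comm]
  have hfin := measure_ne_top_of_subset hsub (μ := μ) measure_ball_lt_top.ne
  have hmeas : μ.real ((⋃ c ∈ s, ball c r) ∪ closedBall 0 (1 - r)) =
      s.card * (r ^ finrank ℝ E * μ.real (ball 0 1)) +
        (1 - r) ^ finrank ℝ E * μ.real (ball 0 1) := by
    rw [measureReal_union hcore measurableSet_closedBall
        (measure_ne_top_of_subset subset_union_left hfin) measure_closedBall_lt_top.ne,
      measureReal_biUnion_finset hdisj fun _ _ => measurableSet_ball,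
      Finset.sum_congr rfl fun c _ => hvol c hr0, Finset.sum_const, nsmul_eq_mul,
      Measure.addHaar_real_closedBall μ 0 (sub_nonneg.2 hr1)]
  have hle := measureReal_mono hsub (μ := μ) measure_ball_lt_top.ne
  rw [hmeas, hvol 0 (by linarith : 0 < 1 + r)] at hle
  refine le_of_mul_le_mul_right ?_ hunit
  linarith

lemma card_le_of_pairwise_disjoint_ball {s : Finset E} {r : ℝ} (hr0 : 0 < r) (hr1 : r ≤ 1)
    (hs : ∀ c ∈ s, ‖c‖ = 1) (hdisj : (s : Set E).PairwiseDisjoint (ball · r)) :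
    (s.card : ℝ) ≤ 2 * finrank ℝ E * (1 + 1 / r) ^ (finrank ℝ E - 1) := by
  have hcard := card_mul_pow_le_of_pairwise_disjoint_ball hr0 hr1 hs hdisj
  set k := finrank ℝ E
  rcases Nat.eq_zero_or_pos k with hk | hk
  · simpa [hk] using hcard
  have hpow : (1 + r) ^ k - (1 - r) ^ k ≤ 2 * r * k * (1 + r) ^ (k - 1) := by
    have hmax : max |1 + r| |1 - r| = 1 + r := by
      rw [abs_of_pos (by linarith), abs_of_nonneg (by linarith), max_eq_left (by linarith)]
    have hdiff : |1 + r - (1 - r)| = 2 * r := by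
      rw [abs_of_pos (by linarith)]
      ring
    simpa only [hmax, hdiff] using (le_abs_self _).trans (abs_pow_sub_pow_le (1 + r) (1 - r) k)
  have hbase : 1 + 1 / r = (1 + r) / r := by
    field_simp
    ring
  refine le_of_mul_le_mul_right (hcard.trans (hpow.trans_eq ?_)) (pow_pos hr0 k)
  rw [hbase, div_pow, ← mul_pow_sub_one hk.ne' r]
  field_simp

lemma exists_finset_net_sphere {ε : ℝ} (hε0 : 0 < ε) (hε2 : ε ≤ 2) :
    ∃ s : Finset E, (∀ c ∈ s, ‖c‖ = 1) ∧ (∀ x : E, ‖x‖ = 1 → ∃ c ∈ s, ‖x - c‖ ≤ ε) ∧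
      (s.card : ℝ) ≤ 2 * finrank ℝ E * (1 + 2 / ε) ^ (finrank ℝ E - 1) := by
  lift ε to ℝ≥0 using hε0.le
  have hpack := packingNumber_ne_top (NNReal.coe_pos.1 hε0).ne' (isCompact_sphere (0 : E) 1)
  have hfin : (maximalSeparatedSet ε (sphere (0 : E) 1)).Finite := by
    rwa [← encard_ne_top_iff, encard_maximalSeparatedSet hpack]
  have hunit : ∀ c ∈ hfin.toFinset, ‖c‖ = 1 := fun c hc => by
    simpa using maximalSeparatedSet_subset (hfin.mem_toFinset.1 hc)
  refine ⟨hfin.toFinset, hunit, fun x hx => ?_, ?_⟩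
  · have hx' : x ∈ sphere (0 : E) 1 := by simpa using hx
    simpa [dist_eq_norm] using (isCover_maximalSeparatedSet hpack).subset_iUnion_closedBall hx'
  · have hcard := card_le_of_pairwise_disjoint_ball (half_pos hε0) ((div_le_one two_pos).2 hε2)
      hunit ?_
    · rwa [one_div_div] at hcard
    · intro c hc c' hc' hne
      have hsep : (ε : ENNReal) < edist c c' :=
        isSeparated_maximalSeparatedSet (hfin.mem_toFinset.1 hc) (hfin.mem_toFinset.1 hc') hne
      refine ball_disjoint_ball ?_
      rw [add_halves, ← coe_nndist, NNReal.coe_le_coe]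
      rw [edist_nndist, ENNReal.coe_lt_coe] at hsep
      exact hsep.le

end SphereNet

section GramLowerBound

section Net

variable {E : Type*} [NormedAddCommGroup E] [InnerProductSpace ℝ E] {ι : Type*} [Fintype ι]

lemma inner_sq_sub_inner_sq_le {x c a : E} (hx : ‖x‖ = 1) (hc : ‖c‖ = 1) (ha : ‖a‖ ≤ 1) :
    ⟪c, a⟫ ^ 2 - ⟪x, a⟫ ^ 2 ≤ 2 * ‖x - c‖ := by
  have hsub : |⟪c - x, a⟫| ≤ ‖x - c‖ := by
    rw [norm_sub_rev]
    exact (abs_real_inner_le_norm _ _).trans (mul_le_of_le_one_right (norm_nonneg _) ha)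
  have hadd : |⟪c + x, a⟫| ≤ 2 := by
    refine (abs_real_inner_le_norm _ _).trans
      ((mul_le_of_le_one_right (norm_nonneg _) ha).trans ((norm_add_le _ _).trans ?_))
    rw [hx, hc, one_add_one_eq_two]
  calc ⟪c, a⟫ ^ 2 - ⟪x, a⟫ ^ 2 = ⟪c + x, a⟫ * ⟪c - x, a⟫ := by
        rw [inner_add_left, inner_sub_left]
        ring
    _ ≤ |⟪c + x, a⟫| * |⟪c - x, a⟫| := (le_abs_self _).trans_eq (abs_mul _ _)
    _ ≤ 2 * ‖x - c‖ := by gcongr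

lemma mul_norm_sq_le_sum_inner_sq_of_net {s : Set E} {ε κ : ℝ} (hs : ∀ c ∈ s, ‖c‖ = 1)
    (hnet : ∀ x : E, ‖x‖ = 1 → ∃ c ∈ s, ‖x - c‖ ≤ ε) {a : ι → E} (ha : ∀ i, ‖a i‖ ≤ 1)
    (hκ : ∀ c ∈ s, κ + Fintype.card ι * (2 * ε) ≤ ∑ i, ⟪c, a i⟫ ^ 2) (x : E) :
    κ * ‖x‖ ^ 2 ≤ ∑ i, ⟪a i, x⟫ ^ 2 := by
  rcases eq_or_ne x 0 with rfl | hx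
  · simp
  obtain ⟨y, hy, hxy⟩ : ∃ y : E, ‖y‖ = 1 ∧ x = ‖x‖ • y :=
    ⟨‖x‖⁻¹ • x, norm_smul_inv_norm hx, (smul_inv_smul₀ (norm_ne_zero_iff.2 hx) x).symm⟩
  have hunit : κ ≤ ∑ i, ⟪y, a i⟫ ^ 2 := by
    obtain ⟨c, hc, hyc⟩ := hnet y hy
    have hdiff : ∑ i, (⟪c, a i⟫ ^ 2 - ⟪y, a i⟫ ^ 2) ≤ Fintype.card ι * (2 * ε) := by
      rw [← nsmul_eq_mul]
      exact Finset.sum_le_card_nsmul _ _ _ fun i _ =>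
        (inner_sq_sub_inner_sq_le hy (hs c hc) (ha i)).trans (by gcongr)
    rw [Finset.sum_sub_distrib] at hdiff
    linarith [hκ c hc]
  have hscale : ∑ i, ⟪a i, x⟫ ^ 2 = (∑ i, ⟪y, a i⟫ ^ 2) * ‖x‖ ^ 2 := by
    rw [Finset.sum_mul]
    refine Finset.sum_congr rfl fun i _ => ?_
    nth_rewrite 1 [hxy]
    rw [real_inner_smul_right, real_inner_comm, mul_pow, mul_comm]
  rw [hscale]
  gcongr

end Net

section SampleSize

variable {U d : ℕ} {p δ N : ℝ}

lemma one_lt_Nmin_arg (hU : 0 < U) (hd : 0 < d) (hp : 0 < p) (hpd : p * d ≤ 1) (hδ0 : 0 < δ)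
    (hδ1 : δ < 1) : 1 < 8 * U * d / (p ^ 2 * δ) := by
  have hU1 : (1 : ℝ) ≤ U := by exact_mod_cast hU
  have hd1 : (1 : ℝ) ≤ d := by exact_mod_cast hd
  have hp1 : p ≤ 1 := (le_mul_of_one_le_right hp.le hd1).trans hpd
  rw [one_lt_div (by positivity)]
  calc p ^ 2 * δ ≤ 1 * δ := by gcongr; exact pow_le_one₀ hp.le hp1
    _ < 8 * 1 * 1 := by linarith
    _ ≤ 8 * U * d := by gcongr

lemma Nmin_pos (hU : 0 < U) (hd : 0 < d) (hp : 0 < p) (hpd : p * d ≤ 1) (hδ0 : 0 < δ)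
    (hδ1 : δ < 1) : 0 < Nmin U d p δ :=
  mul_pos (by positivity) (Real.log_pos (one_lt_Nmin_arg hU hd hp hpd hδ0 hδ1))

lemma exp_neg_mul_le_of_Nmin_le (hU : 0 < U) (hd : 0 < d) (hp : 0 < p) (hpd : p * d ≤ 1)
    (hδ0 : 0 < δ) (hδ1 : δ < 1) (hN : Nmin U d p δ ≤ N) :
    Real.exp (-(1 / 16 * (N * p))) ≤ (p ^ 2 * δ / (8 * U * d)) ^ d := by
  have harg := one_lt_Nmin_arg hU hd hp hpd hδ0 hδ1
  rw [← inv_div (8 * U * d : ℝ)]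
  set r := 8 * U * d / (p ^ 2 * δ) with hr
  have hexp : r⁻¹ ^ d = Real.exp (-(d * Real.log r)) := by
    rw [← mul_neg, ← Real.log_inv, Real.exp_nat_mul, Real.exp_log (by positivity)]
  rw [hexp, Real.exp_le_exp, neg_le_neg_iff]
  calc d * Real.log r ≤ 1 / p * Real.log r := by
        gcongr
        · exact (Real.log_pos harg).le
        · rwa [le_div_iff₀ hp, mul_comm]
    _ = 1 / 16 * (Nmin U d p δ * p) := by
        rw [Nmin, ← hr]
        field_simp
    _ ≤ 1 / 16 * (N * p) := by gcongr

lemma mul_exp_neg_le_of_Nmin_le (hU : 0 < U) (hd : 0 < d) (hp : 0 < p) (hpd : p * d ≤ 1)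
    (hδ0 : 0 < δ) (hδ1 : δ < 1) (hN : Nmin U d p δ ≤ N) :
    2 * d * (1 + 28 / p) ^ (d - 1) * Real.exp (-(1 / 16 * (N * p))) ≤ δ / (2 * U) := by
  have hU1 : (1 : ℝ) ≤ U := by exact_mod_cast hU
  have hd1 : (1 : ℝ) ≤ d := by exact_mod_cast hd
  have hp1 : p ≤ 1 := (le_mul_of_one_le_right hp.le hd1).trans hpd
  set q := p ^ 2 * δ / (8 * U * d) with hq
  have hpow : ((1 + 28 / p) * q) ^ (d - 1) ≤ 1 := by
    rcases (Nat.succ_le_of_lt hd).eq_or_lt with rfl | hd2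
    · simp
    have hd2 : (2 : ℝ) ≤ d := by exact_mod_cast hd2
    have hp2 : p ≤ 1 / 2 := by nlinarith
    refine pow_le_one₀ (by positivity) ?_
    calc (1 + 28 / p) * q = (p + 28) * p * δ / (8 * U * d) := by
          rw [hq]
          field_simp
      _ ≤ (1 / 2 + 28) * (1 / 2) * 1 / (8 * 1 * 2) := by gcongr
      _ ≤ 1 := by norm_num
  calc 2 * d * (1 + 28 / p) ^ (d - 1) * Real.exp (-(1 / 16 * (N * p)))
      ≤ 2 * d * (1 + 28 / p) ^ (d - 1) * q ^ d := by
        gcongr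
        exact exp_neg_mul_le_of_Nmin_le hU hd hp hpd hδ0 hδ1 hN
    _ = 2 * d * q * ((1 + 28 / p) * q) ^ (d - 1) := by
        rw [mul_pow, ← mul_pow_sub_one hd.ne' q]
        ring
    _ ≤ 2 * d * q * 1 := by gcongr
    _ = p ^ 2 / 2 * (δ / (2 * U)) := by
        rw [hq]
        field_simp
        norm_num
    _ ≤ δ / (2 * U) := mul_le_of_le_one_left (by positivity) (by nlinarith)

end SampleSize

variable {Ω : Type*} [MeasurableSpace Ω] {μ : Measure Ω} [IsFiniteMeasure μ] {U d S : ℕ}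
  {D : Dataset Ω U d} {ρ : Measure (Vec d)} {lamA σ p δ : ℝ}

-- A net of mesh `p / 14` loses `2 * (p / 14)` per round and the lower tail bound with deviation
-- `5 / 14` loses another `5 / 14 * p`, which leaves `p / 2` out of `p`.
lemma SelectedFromCandidates.measureReal_not_gram_ge_le (hsel : SelectedFromCandidates μ D ρ S)
    (hρ : LowerRegularLaw ρ lamA σ) (hd : 0 < d) (hp0 : 0 < p)
    (hp : p ≤ smoothedRegularity lamA σ S) (hδ0 : 0 < δ) (hδ1 : δ < 1) (u : Fin U)
    (hN : Nmin U d p δ ≤ D.N u) :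
    μ.real {ω | ¬ ∀ x : Vec d, p * D.N u / 2 * ‖x‖ ^ 2 ≤ ∑ i, ⟪D.action u i ω, x⟫ ^ 2} ≤
      δ / (2 * U) := by
  have hpd := hρ.mul_dim_le_one hp
  have hp1 : p ≤ 1 := (le_mul_of_one_le_right hp0.le (by exact_mod_cast hd)).trans hpd
  obtain ⟨s, hs, hnet, hcard⟩ := exists_finset_net_sphere (E := Vec d) (ε := p / 14)
    (by positivity) (by linarith)
  rw [finrank_euclideanSpace_fin] at hcard
  let low (c : Vec d) : Set Ω :=
    {ω | ∑ i, ⟪c, D.action u i ω⟫ ^ 2 ≤ (1 - 5 / 14) * (D.N u * p)}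
  have hlow : ∀ c ∈ s, μ.real (low c) ≤ Real.exp (-(1 / 16 * (D.N u * p))) := fun c hc =>
    (hsel.measureReal_sum_inner_sq_le hρ u (hs c hc) hp (by norm_num) (by norm_num)).trans <| by
      rw [Real.exp_le_exp, neg_le_neg_iff]
      exact mul_le_mul_of_nonneg_right (by norm_num) (by positivity)
  calc μ.real {ω | ¬ ∀ x : Vec d, p * D.N u / 2 * ‖x‖ ^ 2 ≤ ∑ i, ⟪D.action u i ω, x⟫ ^ 2}
      ≤ μ.real (⋃ c ∈ s, low c) := by
        refine ENNReal.toReal_mono (measure_ne_top μ _) (measure_mono_ae ?_)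
        filter_upwards [hsel.ae_norm_action_le_one hρ.norm_le_one u] with ω hω hbad
        by_contra hgood
        refine hbad (mul_norm_sq_le_sum_inner_sq_of_net (s := s) hs hnet hω fun c hc => ?_)
        have hhigh : (1 - 5 / 14) * (D.N u * p) < ∑ i, ⟪c, D.action u i ω⟫ ^ 2 :=
          lt_of_not_ge fun hle => hgood (mem_biUnion (t := low) hc hle)
        rw [Fintype.card_fin]
        linarith
    _ ≤ ∑ c ∈ s, μ.real (low c) := measureReal_biUnion_finset_le _ _
    _ ≤ s.card * Real.exp (-(1 / 16 * (D.N u * p))) := by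
        rw [← nsmul_eq_mul]
        exact Finset.sum_le_card_nsmul _ _ _ hlow
    _ ≤ 2 * d * (1 + 28 / p) ^ (d - 1) * Real.exp (-(1 / 16 * (D.N u * p))) := by
        have hmesh : 2 / (p / 14) = 28 / p := by
          field_simp
          norm_num
        rw [← hmesh]
        gcongr
    _ ≤ δ / (2 * U) := mul_exp_neg_le_of_Nmin_le u.pos hd hp0 hpd hδ0 hδ1 hN

end GramLowerBound

section RidgeError

variable {Ω : Type*} [MeasurableSpace Ω] {μ : Measure Ω} {U d : ℕ} {D : Dataset Ω U d}
  {θ : Fin U → Vec d} {u : Fin U} {p lam δ : ℝ}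

/-- The reward noise `rᵢ - ⟪θ_u, aᵢ⟫` of user `u` in round `i`. -/
def Dataset.noise (D : Dataset Ω U d) (θ : Fin U → Vec d) (u : Fin U) (i : Fin (D.N u)) (ω : Ω) :
    ℝ :=
  D.reward u i ω - ⟪θ u, D.action u i ω⟫

lemma Dataset.measurable_noise (i : Fin (D.N u)) : Measurable (D.noise θ u i) := by
  have := D.measurable_action u i
  have := D.measurable_reward u i
  unfold Dataset.noise
  fun_prop

lemma Dataset.history_le (i : Fin (D.N u)) : D.history u i ≤ ‹MeasurableSpace Ω› :=
  sup_le (iSup₂_le fun j _ => (D.measurable_action u j).comap_le)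
    (iSup₂_le fun j _ => (D.measurable_reward u j).comap_le)

lemma Dataset.measurable_action_history {i j : Fin (D.N u)} (h : j ≤ i) :
    Measurable[D.history u i] (D.action u j) :=
  measurable_iff_comap_le.2 (le_sup_of_le_left (le_iSup₂_of_le j h le_rfl))

lemma Dataset.measurable_reward_history {i j : Fin (D.N u)} (h : j < i) :
    Measurable[D.history u i] (D.reward u j) :=
  measurable_iff_comap_le.2 (le_sup_of_le_right (le_iSup₂_of_le j h le_rfl))

lemma Dataset.measurable_noise_history {i j : Fin (D.N u)} (h : j < i) :
    Measurable[D.history u i] (D.noise θ u j) :=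
  (D.measurable_reward_history h).sub
    ((innerSL ℝ (θ u)).continuous.measurable.comp (D.measurable_action_history h.le))

lemma SubGaussianRewards.sequentialDesign (hrew : SubGaussianRewards μ D θ) (u : Fin U) :
    SequentialDesign (D.history u) μ (D.action u) (D.noise θ u) where
  le := D.history_le
  measurable_design_of_le _ _ := D.measurable_action_history
  measurable_noise_of_lt _ _ := D.measurable_noise_history
  condSubGaussian i := ⟨D.measurable_noise i, fun t => (hrew u i t).1, fun t => (hrew u i t).2⟩

lemma Dataset.ridge_eq_ridgeSolve (ω : Ω) :
    D.ridge lam u ω = ridgeSolve lam (fun i => D.action u i ω) (D.moment u ω) :=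
  rfl

lemma Dataset.moment_eq_sum_noise_add (ω : Ω) :
    D.moment u ω = ∑ i, D.noise θ u i ω • D.action u i ω +
      ∑ i, ⟪D.action u i ω, θ u⟫ • D.action u i ω := by
  rw [Dataset.moment, ← Finset.sum_add_distrib]
  refine Finset.sum_congr rfl fun i _ => ?_
  rw [Dataset.noise, ← add_smul, real_inner_comm, sub_add_cancel]

lemma log_two_mul_div_pos (hU : 0 < U) (hδ0 : 0 < δ) (hδ1 : δ < 1) :
    0 < Real.log (2 * U / δ) := by
  have hU1 : (1 : ℝ) ≤ U := by exact_mod_cast hU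
  refine Real.log_pos ?_
  rw [one_lt_div hδ0]
  linarith

lemma log_one_add_div_nonneg (hlam : 0 < lam) (N d : ℕ) :
    0 ≤ Real.log (1 + N / (lam * d)) :=
  Real.log_nonneg (le_add_of_nonneg_right (by positivity))

lemma Dataset.norm_ridge_sub_lt_CI (hlam : 0 < lam) (hθ : ‖θ u‖ ≤ 1) (hp : 0 < p)
    (hN : 0 < D.N u) (hL : 0 ≤ Real.log (2 * U / δ)) {ω : Ω}
    (hnoise : ⟪ridgeSolve lam (fun i => D.action u i ω) (∑ i, D.noise θ u i ω • D.action u i ω),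
      ∑ i, D.noise θ u i ω • D.action u i ω⟫ ≤
        d * Real.log (1 + D.N u / (lam * d)) + 2 * Real.log (2 * U / δ))
    (hgram : ∀ x : Vec d, p * D.N u / 2 * ‖x‖ ^ 2 ≤ ∑ i, ⟪D.action u i ω, x⟫ ^ 2) :
    ‖D.ridge lam u ω - θ u‖ < D.CI p lam δ u := by
  have hlog := log_one_add_div_nonneg hlam (D.N u) d
  have : (0 : ℝ) < D.N u := by exact_mod_cast hN
  rw [Dataset.ridge_eq_ridgeSolve, D.moment_eq_sum_noise_add (θ := θ)]
  exact norm_ridgeSolve_sub_lt hlam _ hθ (Real.sqrt_nonneg _) (by positivity)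
    (hnoise.trans_eq (Real.sq_sqrt (by positivity)).symm) hgram

lemma measureReal_CI_le_norm_ridge_sub_le [IsProbabilityMeasure μ] {ρ : Measure (Vec d)}
    {lamA σ : ℝ} {S : ℕ} (hρ : LowerRegularLaw ρ lamA σ) (hd : 0 < d)
    (hsel : SelectedFromCandidates μ D ρ S) (hrew : SubGaussianRewards μ D θ)
    (hθ : ∀ u, ‖θ u‖ ≤ 1) (hp0 : 0 < p) (hp : p ≤ smoothedRegularity lamA σ S) (hlam : 0 < lam)
    (hδ0 : 0 < δ) (hδ1 : δ < 1) (hN : Nmin U d p δ ≤ D.N u) :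
    μ.real {ω | D.CI p lam δ u ≤ ‖D.ridge lam u ω - θ u‖} ≤ δ / U := by
  have hU : (0 : ℝ) < U := by exact_mod_cast u.pos
  have : Nonempty (Fin d) := ⟨⟨0, hd⟩⟩
  have hN0 : 0 < D.N u := by
    exact_mod_cast (Nmin_pos u.pos hd hp0 (hρ.mul_dim_le_one hp) hδ0 hδ1).trans_le hN
  have hgram := hsel.measureReal_not_gram_ge_le hρ hd hp0 hp hδ0 hδ1 u hN
  have hnoise := ENNReal.toReal_le_of_le_ofReal (by positivity)
    ((hrew.sequentialDesign u).measure_lt_inner_ridgeSolve_le hlam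
      (hsel.ae_norm_action_le_one hρ.norm_le_one u) (ε := δ / (2 * U)) (by positivity))
  rw [one_div_div, Fintype.card_fin] at hnoise
  have hsplit : δ / U = δ / (2 * U) + δ / (2 * U) := by
    field_simp
    norm_num
  rw [hsplit]
  refine (measureReal_mono fun ω hω => ?_).trans
    ((measureReal_union_le _ _).trans (add_le_add hgram hnoise))
  by_contra hgood
  obtain ⟨hgram_ge, hnoise_le⟩ := not_or.1 hgood
  exact not_lt.2 hω (Dataset.norm_ridge_sub_lt_CI hlam (hθ u) hp0 hN0
    (log_two_mul_div_pos u.pos hδ0 hδ1).le (not_lt.1 hnoise_le) (not_not.1 hgram_ge))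

end RidgeError

section GraphMeasurability

variable {Ω : Type*} [MeasurableSpace Ω] {U d : ℕ} (D : Dataset Ω U d)

lemma Dataset.measurable_ridge (lam : ℝ) (u : Fin U) : Measurable (D.ridge lam u) := by
  have hmoment : Measurable (D.moment u) := by
    have := D.measurable_action u
    have := D.measurable_reward u
    unfold Dataset.moment
    fun_prop
  have haction : Measurable fun ω i => D.action u i ω :=
    measurable_pi_lambda _ (D.measurable_action u)
  have hsolve := (measurable_ridgeSolve (lam := lam)).comp (haction.prodMk hmoment)
  exact hsolve

lemma Dataset.measurableSet_adj (lamT α lam δ γhat : ℝ) (u v : Fin U) :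
    MeasurableSet {ω | (D.graph lamT α lam δ γhat ω).Adj u v} := by
  have hu := D.measurable_ridge lam u
  have hv := D.measurable_ridge lam v
  have hclose : MeasurableSet {ω | ‖D.ridge lam u ω - D.ridge lam v ω‖ <
      γhat - α * (D.CI lamT lam δ u + D.CI lamT lam δ v)} :=
    measurableSet_lt (by fun_prop) measurable_const
  exact (MeasurableSet.const _).inter (hclose.inter (MeasurableSet.const _))

end GraphMeasurability

section ConfidenceRadius

variable {Ω : Type*} [MeasurableSpace Ω] {U d : ℕ} (D : Dataset Ω U d) {u v : Fin U}
  {p lam δ : ℝ}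

lemma Dataset.sqrt_mul_CI (hp : 0 < p) (hN : 0 < D.N u) :
    √p * D.CI p lam δ u =
      √2 * (√(d * Real.log (1 + D.N u / (lam * d)) + 2 * Real.log (2 * U / δ)) + √lam) *
        (1 / √(D.N u)) := by
  have : (0 : ℝ) < D.N u := by exact_mod_cast hN
  rw [Dataset.CI, Real.sqrt_div (by positivity), Real.sqrt_mul hp.le]
  field_simp

lemma Dataset.lt_sqrt_mul_CI (hp : 0 < p) (hlam : 0 < lam) (hN : 0 < D.N u) :
    2 * √(Real.log (2 * U / δ)) * (1 / √(D.N u)) < √p * D.CI p lam δ u := by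
  have hlog := log_one_add_div_nonneg hlam (D.N u) d
  have : (0 : ℝ) < D.N u := by exact_mod_cast hN
  rw [D.sqrt_mul_CI hp hN]
  refine mul_lt_mul_of_pos_right ?_ (by positivity)
  calc 2 * √(Real.log (2 * U / δ)) = √2 * √(2 * Real.log (2 * U / δ)) := by
        rw [Real.sqrt_mul zero_le_two, ← mul_assoc, Real.mul_self_sqrt zero_le_two]
    _ ≤ √2 * √(d * Real.log (1 + D.N u / (lam * d)) + 2 * Real.log (2 * U / δ)) := by
        gcongr
        exact le_add_of_nonneg_left (by positivity)
    _ < _ := by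
        gcongr
        exact lt_add_of_pos_right _ (Real.sqrt_pos.2 hlam)

lemma Dataset.sqrt_mul_CI_le (hp : 0 < p) (hlam : 0 < lam) (hN : 0 < D.N u) (hδ0 : 0 < δ)
    (hδ1 : δ < 1)
    (hlam_le : lam ≤ d * Real.log (1 + D.N u / (lam * d)) + 2 * Real.log (2 * U / δ))
    (hδ_le : δ ≤ 2 * U / (1 + D.N u / (lam * d))) :
    √p * D.CI p lam δ u ≤ 4 * √(Real.log (2 * U / δ) * max 2 (d : ℝ)) * (1 / √(D.N u)) := by
  have hL := log_two_mul_div_pos u.pos hδ0 hδ1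
  have hlog : Real.log (1 + D.N u / (lam * d)) ≤ Real.log (2 * U / δ) :=
    Real.log_le_log (by positivity) ((le_div_comm₀ hδ0 (by positivity)).1 hδ_le)
  rw [D.sqrt_mul_CI hp hN]
  refine mul_le_mul_of_nonneg_right ?_ (by positivity)
  set L := Real.log (2 * U / δ)
  set b := d * Real.log (1 + D.N u / (lam * d)) + 2 * L
  have hb : b ≤ 2 * (L * max 2 (d : ℝ)) := by
    calc b ≤ d * L + 2 * L := by
          unfold b
          gcongr
      _ ≤ max 2 (d : ℝ) * L + max 2 (d : ℝ) * L := by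
          gcongr
          · exact le_max_right _ _
          · exact le_max_left _ _
      _ = 2 * (L * max 2 (d : ℝ)) := by ring
  calc √2 * (√b + √lam) ≤ √2 * (√b + √b) := by gcongr
    _ ≤ √2 * (√(2 * (L * max 2 (d : ℝ))) + √(2 * (L * max 2 (d : ℝ)))) := by gcongr
    _ = 2 * (√2 * √2) * √(L * max 2 (d : ℝ)) := by
        rw [Real.sqrt_mul zero_le_two]
        ring
    _ = 4 * √(L * max 2 (d : ℝ)) := by
        rw [Real.mul_self_sqrt zero_le_two]
        norm_num

/-- The order `1 / √N_u + 1 / √N_v` of the sum of the confidence radii of `u` and `v`; the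
thresholds for the edges of the graph are expressed through it. -/
def Dataset.pairRate (u v : Fin U) : ℝ :=
  1 / √(D.N u) + 1 / √(D.N v)

lemma Dataset.pairRate_nonneg (u v : Fin U) : 0 ≤ D.pairRate u v := by
  unfold Dataset.pairRate
  positivity

lemma Dataset.pairRate_pos (hN : 0 < D.N u) (v : Fin U) : 0 < D.pairRate u v := by
  have : (0 : ℝ) < D.N u := by exact_mod_cast hN
  unfold Dataset.pairRate
  positivity

lemma Dataset.mul_pairRate_lt_CI_add (hp : 0 < p) (hlam : 0 < lam) (hNu : 0 < D.N u)
    (hNv : 0 < D.N v) :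
    2 * √(Real.log (2 * U / δ)) * D.pairRate u v <
      √p * (D.CI p lam δ u + D.CI p lam δ v) := by
  rw [Dataset.pairRate, mul_add, mul_add]
  exact add_lt_add (D.lt_sqrt_mul_CI hp hlam hNu) (D.lt_sqrt_mul_CI hp hlam hNv)

end ConfidenceRadius

section EdgeThresholds

variable {Ω : Type*} [MeasurableSpace Ω] {U d : ℕ} {D : Dataset Ω U d} {θ : Fin U → Vec d}
  {p α lam δ γhat γ : ℝ} {u v : Fin U} {ω : Ω}

/-- Lower end of the range of the factors `α_r`. On accurate estimates, two users with equal
preference vectors are connected as soon as their pair rate is at most this multiple of `γhat`. -/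
def homogeneousFactorLower (U d : ℕ) (p α δ : ℝ) : ℝ :=
  √p / (4 * (α + 1) * √(Real.log (2 * U / δ) * max 2 (d : ℝ)))

/-- Upper end of the range of the factors `α_r`. The pair rate of connected users is less than
this multiple of `γhat`. -/
def homogeneousFactorUpper (U : ℕ) (p α δ : ℝ) : ℝ :=
  √p / (2 * α * √(Real.log (2 * U / δ)))

/-- Upper end of the range of the factors `α_w`, meaningful only for `1 < α`. On accurate
estimates, the pair rate of connected users with different preference vectors is at most this
multiple of `γhat - γ`. -/
def heterogeneousFactorUpper (U : ℕ) (p α δ : ℝ) : ℝ :=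
  √p / (2 * (α - 1) * √(Real.log (2 * U / δ)))

lemma homogeneousFactorLower_nonneg (hα : 0 ≤ α + 1) : 0 ≤ homogeneousFactorLower U d p α δ := by
  unfold homogeneousFactorLower
  positivity

lemma homogeneousFactorLower_lt_upper (hU : 0 < U) (hp : 0 < p) (hα : 0 < α) (hδ0 : 0 < δ)
    (hδ1 : δ < 1) : homogeneousFactorLower U d p α δ < homogeneousFactorUpper U p α δ := by
  have hL := log_two_mul_div_pos hU hδ0 hδ1
  refine div_lt_div_of_pos_left (Real.sqrt_pos.2 hp) (by positivity) ?_
  calc 2 * α * √(Real.log (2 * U / δ)) < 4 * (α + 1) * √(Real.log (2 * U / δ)) := by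
        gcongr <;> linarith
    _ ≤ 4 * (α + 1) * √(Real.log (2 * U / δ) * max 2 (d : ℝ)) := by
        gcongr
        exact le_mul_of_one_le_right hL.le (one_le_two.trans (le_max_left _ _))

lemma heterogeneousFactorUpper_pos (hU : 0 < U) (hp : 0 < p) (hα : 1 < α) (hδ0 : 0 < δ)
    (hδ1 : δ < 1) : 0 < heterogeneousFactorUpper U p α δ := by
  have hL := log_two_mul_div_pos hU hδ0 hδ1
  have := sub_pos.2 hα
  unfold heterogeneousFactorUpper
  positivity

/-- The ridge estimate of every user with at least `Nmin` samples lies within the confidence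
radius; this is the good event of the theorem. -/
def Dataset.RidgeAccurate (D : Dataset Ω U d) (θ : Fin U → Vec d) (p lam δ : ℝ) (ω : Ω) : Prop :=
  ∀ u, Nmin U d p δ ≤ D.N u → ‖D.ridge lam u ω - θ u‖ < D.CI p lam δ u

lemma Dataset.pos_of_Nmin_le (hNmin : 0 < Nmin U d p δ) (h : Nmin U d p δ ≤ D.N u) :
    0 < D.N u := by
  exact_mod_cast hNmin.trans_le h

lemma Dataset.Nmin_le_of_adj (h : (D.graph p α lam δ γhat ω).Adj u v) :
    Nmin U d p δ ≤ D.N u ∧ Nmin U d p δ ≤ D.N v :=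
  le_min_iff.1 h.2.2

lemma Dataset.pairRate_lt_of_adj (hp : 0 < p) (hlam : 0 < lam) (hα : 0 < α) (hδ0 : 0 < δ)
    (hδ1 : δ < 1) (hNmin : 0 < Nmin U d p δ) (h : (D.graph p α lam δ γhat ω).Adj u v) :
    D.pairRate u v < homogeneousFactorUpper U p α δ * γhat := by
  obtain ⟨hu, hv⟩ := Dataset.Nmin_le_of_adj h
  have hrate := D.mul_pairRate_lt_CI_add (δ := δ) hp hlam (Dataset.pos_of_Nmin_le hNmin hu)
    (Dataset.pos_of_Nmin_le hNmin hv)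
  have hL := log_two_mul_div_pos u.pos hδ0 hδ1
  have hCI : α * (D.CI p lam δ u + D.CI p lam δ v) ≤ γhat := by
    linarith [h.2.1, norm_nonneg (D.ridge lam u ω - D.ridge lam v ω)]
  rw [homogeneousFactorUpper, div_mul_eq_mul_div, lt_div_iff₀ (by positivity)]
  calc D.pairRate u v * (2 * α * √(Real.log (2 * U / δ)))
      = α * (2 * √(Real.log (2 * U / δ)) * D.pairRate u v) := by ring
    _ < α * (√p * (D.CI p lam δ u + D.CI p lam δ v)) := by gcongr
    _ = √p * (α * (D.CI p lam δ u + D.CI p lam δ v)) := by ring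
    _ ≤ √p * γhat := by gcongr

lemma Dataset.lt_pairRate_of_not_adj (hp : 0 < p) (hα : 0 < α + 1) (hδ0 : 0 < δ) (hδ1 : δ < 1)
    (hCI : ∀ u, Nmin U d p δ ≤ D.N u →
      √p * D.CI p lam δ u ≤ 4 * √(Real.log (2 * U / δ) * max 2 (d : ℝ)) * (1 / √(D.N u)))
    (hacc : D.RidgeAccurate θ p lam δ ω) (huv : u ≠ v) (hθ : θ u = θ v)
    (hNu : Nmin U d p δ ≤ D.N u) (hNv : Nmin U d p δ ≤ D.N v)
    (h : ¬ (D.graph p α lam δ γhat ω).Adj u v) :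
    homogeneousFactorLower U d p α δ * γhat < D.pairRate u v := by
  have hL := log_two_mul_div_pos u.pos hδ0 hδ1
  have hfar : γhat - α * (D.CI p lam δ u + D.CI p lam δ v) ≤
      ‖D.ridge lam u ω - D.ridge lam v ω‖ :=
    not_lt.1 fun hlt => h ⟨huv, hlt, le_min hNu hNv⟩
  have htri : ‖D.ridge lam u ω - D.ridge lam v ω‖ ≤
      ‖D.ridge lam u ω - θ u‖ + ‖D.ridge lam v ω - θ v‖ := by
    rw [show D.ridge lam u ω - D.ridge lam v ω =
      (D.ridge lam u ω - θ u) - (D.ridge lam v ω - θ v) by rw [hθ]; abel]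
    exact norm_sub_le _ _
  have hγhat : γhat < (α + 1) * (D.CI p lam δ u + D.CI p lam δ v) := by
    linarith [hacc u hNu, hacc v hNv]
  rw [homogeneousFactorLower, div_mul_eq_mul_div, div_lt_iff₀ (by positivity)]
  set B := √(Real.log (2 * U / δ) * max 2 (d : ℝ))
  calc √p * γhat < √p * ((α + 1) * (D.CI p lam δ u + D.CI p lam δ v)) := by gcongr
    _ = (α + 1) * (√p * D.CI p lam δ u + √p * D.CI p lam δ v) := by ring
    _ ≤ (α + 1) * (4 * B * (1 / √(D.N u)) + 4 * B * (1 / √(D.N v))) :=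
        mul_le_mul_of_nonneg_left (add_le_add (hCI u hNu) (hCI v hNv)) hα.le
    _ = D.pairRate u v * (4 * (α + 1) * B) := by
        rw [Dataset.pairRate]
        ring

lemma Dataset.norm_sub_lt_of_adj (hacc : D.RidgeAccurate θ p lam δ ω)
    (h : (D.graph p α lam δ γhat ω).Adj u v) :
    ‖θ u - θ v‖ < γhat - (α - 1) * (D.CI p lam δ u + D.CI p lam δ v) := by
  obtain ⟨hu, hv⟩ := Dataset.Nmin_le_of_adj h
  have htri : ‖θ u - θ v‖ ≤ ‖D.ridge lam u ω - D.ridge lam v ω‖ +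
      ‖D.ridge lam u ω - θ u‖ + ‖D.ridge lam v ω - θ v‖ := by
    rw [show θ u - θ v = (D.ridge lam u ω - D.ridge lam v ω) - (D.ridge lam u ω - θ u) +
      (D.ridge lam v ω - θ v) by abel]
    exact (norm_add_le _ _).trans (by gcongr; exact norm_sub_le _ _)
  linarith [h.2.1, hacc u hu, hacc v hv]

lemma Dataset.norm_sub_lt_of_adj_of_one_le (hα : 1 ≤ α) (hacc : D.RidgeAccurate θ p lam δ ω)
    (h : (D.graph p α lam δ γhat ω).Adj u v) : ‖θ u - θ v‖ < γhat := by
  obtain ⟨hu, hv⟩ := Dataset.Nmin_le_of_adj h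
  have hCI : 0 ≤ D.CI p lam δ u + D.CI p lam δ v :=
    add_nonneg ((norm_nonneg _).trans (hacc u hu).le) ((norm_nonneg _).trans (hacc v hv).le)
  linarith [Dataset.norm_sub_lt_of_adj hacc h, mul_nonneg (sub_nonneg.2 hα) hCI]

lemma Dataset.pairRate_le_of_adj (hp : 0 < p) (hlam : 0 < lam) (hα : 1 < α) (hδ0 : 0 < δ)
    (hδ1 : δ < 1) (hNmin : 0 < Nmin U d p δ) (hacc : D.RidgeAccurate θ p lam δ ω)
    (hγ : γ ≤ ‖θ u - θ v‖) (h : (D.graph p α lam δ γhat ω).Adj u v) :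
    D.pairRate u v ≤ heterogeneousFactorUpper U p α δ * (γhat - γ) := by
  obtain ⟨hu, hv⟩ := Dataset.Nmin_le_of_adj h
  have hrate := D.mul_pairRate_lt_CI_add (δ := δ) hp hlam (Dataset.pos_of_Nmin_le hNmin hu)
    (Dataset.pos_of_Nmin_le hNmin hv)
  have hL := log_two_mul_div_pos u.pos hδ0 hδ1
  have := sub_pos.2 hα
  have hCI : (α - 1) * (D.CI p lam δ u + D.CI p lam δ v) ≤ γhat - γ := by
    linarith [Dataset.norm_sub_lt_of_adj hacc h]
  rw [heterogeneousFactorUpper, div_mul_eq_mul_div, le_div_iff₀ (by positivity)]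
  calc D.pairRate u v * (2 * (α - 1) * √(Real.log (2 * U / δ)))
      = (α - 1) * (2 * √(Real.log (2 * U / δ)) * D.pairRate u v) := by ring
    _ ≤ (α - 1) * (√p * (D.CI p lam δ u + D.CI p lam δ v)) := by gcongr
    _ = √p * ((α - 1) * (D.CI p lam δ u + D.CI p lam δ v)) := by ring
    _ ≤ √p * (γhat - γ) := by gcongr

end EdgeThresholds

section GraphDescription

variable {Ω : Type*} [MeasurableSpace Ω] {U d : ℕ} {D : Dataset Ω U d} {θ : Fin U → Vec d}
  {p α lam δ γhat γ : ℝ} {u v : Fin U} {ω : Ω}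

lemma measureReal_not_ridgeAccurate_le {μ : Measure Ω} [IsProbabilityMeasure μ]
    {ρ : Measure (Vec d)} {lamA σ : ℝ} {S : ℕ} (hρ : LowerRegularLaw ρ lamA σ) (hd : 0 < d)
    (hsel : SelectedFromCandidates μ D ρ S) (hrew : SubGaussianRewards μ D θ)
    (hθ : ∀ u, ‖θ u‖ ≤ 1) (hp0 : 0 < p) (hp : p ≤ smoothedRegularity lamA σ S) (hlam : 0 < lam)
    (hδ0 : 0 < δ) (hδ1 : δ < 1) : μ.real {ω | ¬ D.RidgeAccurate θ p lam δ ω} ≤ δ := by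
  let bad (u : Fin U) : Set Ω :=
    {ω | Nmin U d p δ ≤ D.N u ∧ D.CI p lam δ u ≤ ‖D.ridge lam u ω - θ u‖}
  have hbad : ∀ u, μ.real (bad u) ≤ δ / U := fun u => by
    by_cases hN : Nmin U d p δ ≤ D.N u
    · exact (measureReal_mono fun _ h => h.2).trans
        (measureReal_CI_le_norm_ridge_sub_le hρ hd hsel hrew hθ hp0 hp hlam hδ0 hδ1 hN)
    · simp only [bad, hN, false_and, ofPred_false, measureReal_empty]
      positivity
  calc μ.real {ω | ¬ D.RidgeAccurate θ p lam δ ω} = μ.real (⋃ u, bad u) := by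
        congr 1
        ext ω
        simp only [Dataset.RidgeAccurate, bad, mem_ofPred_eq, mem_iUnion, not_forall, not_lt,
          exists_prop]
    _ ≤ ∑ u, μ.real (bad u) := measureReal_iUnion_fintype_le _
    _ ≤ ∑ _u : Fin U, δ / U := Finset.sum_le_sum fun u _ => hbad u
    _ = U * (δ / U) := by simp only [Finset.sum_const, Finset.card_fin, nsmul_eq_mul]
    _ ≤ δ := by
        rw [mul_div_left_comm]
        exact mul_le_of_le_one_right hδ0.le (div_self_le_one _)

lemma exists_homogeneousFactor (hp : 0 < p) (hlam : 0 < lam) (hα : 0 < α) (hδ0 : 0 < δ)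
    (hδ1 : δ < 1) (hNmin : 0 < Nmin U d p δ)
    (hCI : ∀ u, Nmin U d p δ ≤ D.N u →
      √p * D.CI p lam δ u ≤ 4 * √(Real.log (2 * U / δ) * max 2 (d : ℝ)) * (1 / √(D.N u)))
    (u v : Fin U) :
    ∃ a : Ω → ℝ, Measurable a ∧
      (∀ ω, a ω ∈ Ico (homogeneousFactorLower U d p α δ) (homogeneousFactorUpper U p α δ)) ∧
      ∀ ω, D.RidgeAccurate θ p lam δ ω → Nmin U d p δ ≤ D.N u → u ≠ v → θ u = θ v →
        ((D.graph p α lam δ γhat ω).Adj u v ↔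
          D.pairRate u v ≤ a ω * γhat ∧ Nmin U d p δ ≤ D.N v) := by
  classical
  set lower := homogeneousFactorLower U d p α δ
  set upper := homogeneousFactorUpper U p α δ
  have hlower : 0 ≤ lower := homogeneousFactorLower_nonneg (by positivity)
  have hlt : lower < upper := homogeneousFactorLower_lt_upper u.pos hp hα hδ0 hδ1
  have hrate {ω} (h : (D.graph p α lam δ γhat ω).Adj u v) : D.pairRate u v < upper * γhat :=
    Dataset.pairRate_lt_of_adj hp hlam hα hδ0 hδ1 hNmin h
  have hγhat {ω} (h : (D.graph p α lam δ γhat ω).Adj u v) : 0 < γhat :=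
    pos_of_mul_pos_right ((D.pairRate_nonneg u v).trans_lt (hrate h)) (hlower.trans hlt.le)
  refine ⟨fun ω => if (D.graph p α lam δ γhat ω).Adj u v then
      max lower (D.pairRate u v / γhat) else lower,
    Measurable.ite (D.measurableSet_adj p α lam δ γhat u v) measurable_const measurable_const,
    fun ω => ?_, fun ω hacc hNu huv hθ => ?_⟩
  · dsimp only
    split_ifs with h
    · exact ⟨le_max_left _ _, max_lt hlt ((div_lt_iff₀ (hγhat h)).2 (hrate h))⟩
    · exact ⟨le_rfl, hlt⟩
  · dsimp only
    split_ifs with h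
    · simp only [h, true_iff]
      exact ⟨(div_le_iff₀ (hγhat h)).1 (le_max_right _ _), (Dataset.Nmin_le_of_adj h).2⟩
    · simp only [h, false_iff, not_and']
      exact fun hNv => (Dataset.lt_pairRate_of_not_adj hp (by positivity) hδ0 hδ1 hCI hacc huv hθ
        hNu hNv h).not_ge

lemma exists_pos_factor_le {P : Prop} {c g s : ℝ} (hc : P → 0 < c) :
    ∃ w, 0 < w ∧ (P → w ≤ c) ∧ (0 < g → (P → s ≤ c * g) → s ≤ w * g) := by
  by_cases hP : P
  · exact ⟨c, hc hP, fun _ => le_rfl, fun _ hs => hs hP⟩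
  · exact ⟨max 1 (s / g), by positivity, fun h => absurd h hP,
      fun hg _ => (div_le_iff₀ hg).1 (le_max_right _ _)⟩

lemma exists_mem_Ioc_mul_lt {c s : ℝ} (hc : 0 < c) (hs : 0 < s) (g : ℝ) :
    ∃ z ∈ Ioc 0 c, z * g < s := by
  refine ⟨min c (s / (|g| + 1)), ⟨by positivity, min_le_left _ _⟩, ?_⟩
  calc min c (s / (|g| + 1)) * g ≤ min c (s / (|g| + 1)) * |g| := by gcongr; exact le_abs_self g
    _ ≤ s / (|g| + 1) * |g| := by gcongr; exact min_le_right _ _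
    _ < s / (|g| + 1) * (|g| + 1) := by gcongr; exact lt_add_one _
    _ = s := div_mul_cancel₀ s (by positivity)

lemma exists_heterogeneousFactor (hp : 0 < p) (hlam : 0 < lam) (hα : 1 ≤ α) (hδ0 : 0 < δ)
    (hδ1 : δ < 1) (hNmin : 0 < Nmin U d p δ) (hgap : ∀ u v, θ u ≠ θ v → γ ≤ ‖θ u - θ v‖)
    (u v : Fin U) :
    ∃ a : Ω → ℝ, Measurable a ∧
      (∀ ω, 0 < a ω ∧ (1 < α → a ω ≤ heterogeneousFactorUpper U p α δ)) ∧
      ∀ ω, D.RidgeAccurate θ p lam δ ω → Nmin U d p δ ≤ D.N u → θ u ≠ θ v →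
        ((D.graph p α lam δ γhat ω).Adj u v ↔
          ‖θ u - θ v‖ ≤ γhat ∧ D.pairRate u v ≤ a ω * (γhat - γ) ∧ Nmin U d p δ ≤ D.N v) := by
  classical
  obtain ⟨w, hw, hw_le, hadj⟩ := exists_pos_factor_le (g := γhat - γ) (s := D.pairRate u v)
    fun hα => heterogeneousFactorUpper_pos u.pos hp hα hδ0 hδ1
  obtain ⟨z, ⟨hz, hzw⟩, hnadj⟩ : ∃ z ∈ Ioc 0 w,
      Nmin U d p δ ≤ D.N u → z * (γhat - γ) < D.pairRate u v := by
    by_cases hNu : Nmin U d p δ ≤ D.N u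
    · obtain ⟨z, hz, hlt⟩ := exists_mem_Ioc_mul_lt hw
        (D.pairRate_pos (Dataset.pos_of_Nmin_le hNmin hNu) v) (γhat - γ)
      exact ⟨z, hz, fun _ => hlt⟩
    · exact ⟨w, ⟨hw, le_rfl⟩, fun h => absurd h hNu⟩
  refine ⟨fun ω => if (D.graph p α lam δ γhat ω).Adj u v then w else z,
    Measurable.ite (D.measurableSet_adj p α lam δ γhat u v) measurable_const measurable_const,
    fun ω => ?_, fun ω hacc hNu hθ => ?_⟩
  · dsimp only
    split_ifs
    · exact ⟨hw, hw_le⟩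
    · exact ⟨hz, fun hα => hzw.trans (hw_le hα)⟩
  · dsimp only
    split_ifs with h
    · have hnear := Dataset.norm_sub_lt_of_adj_of_one_le hα hacc h
      simp only [h, true_iff]
      exact ⟨hnear.le,
        hadj (by linarith [hgap u v hθ]) fun hα =>
          Dataset.pairRate_le_of_adj hp hlam hα hδ0 hδ1 hNmin hacc (hgap u v hθ) h,
        (Dataset.Nmin_le_of_adj h).2⟩
    · simp only [h, false_iff]
      exact fun h => (hnadj hNu).not_ge h.2.1

/-- The description of the sets `R` and `W` for the factors `αr` and `αw`. -/
def Dataset.ThresholdDescription (D : Dataset Ω U d) (θ : Fin U → Vec d)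
    (p α lam δ γhat γ : ℝ) (αr αw : Fin U → Fin U → ℝ) (ω : Ω) : Prop :=
  ∀ u, (Nmin U d p δ ≤ D.N u →
      D.R θ p α lam δ γhat u ω =
        {u} ∪ {v | θ u = θ v ∧ D.pairRate u v ≤ αr u v * γhat ∧ Nmin U d p δ ≤ D.N v} ∧
      D.W θ p α lam δ γhat u ω =
        {v | (γ ≤ ‖θ u - θ v‖ ∧ ‖θ u - θ v‖ ≤ γhat) ∧
          D.pairRate u v ≤ αw u v * (γhat - γ) ∧ Nmin U d p δ ≤ D.N v}) ∧
    (D.N u < Nmin U d p δ →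
      D.R θ p α lam δ γhat u ω = {u} ∧ D.W θ p α lam δ γhat u ω = ∅)

lemma Dataset.R_eq_union_adj :
    D.R θ p α lam δ γhat u ω = {u} ∪ {v | θ u = θ v ∧ (D.graph p α lam δ γhat ω).Adj u v} := by
  ext v
  simp only [Dataset.R, Dataset.nbhd, mem_ofPred_eq, mem_union, mem_singleton_iff]
  grind

lemma Dataset.W_eq_setOf_adj :
    D.W θ p α lam δ γhat u ω = {v | θ u ≠ θ v ∧ (D.graph p α lam δ γhat ω).Adj u v} := by
  ext v
  simp only [Dataset.W, Dataset.nbhd, mem_ofPred_eq, mem_union, mem_singleton_iff]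
  grind

lemma Dataset.thresholdDescription_of_adj_iff {αr αw : Fin U → Fin U → ℝ} (hγ : 0 < γ)
    (hgap : ∀ u v, θ u ≠ θ v → γ ≤ ‖θ u - θ v‖)
    (hr : ∀ u v, Nmin U d p δ ≤ D.N u → u ≠ v → θ u = θ v →
      ((D.graph p α lam δ γhat ω).Adj u v ↔
        D.pairRate u v ≤ αr u v * γhat ∧ Nmin U d p δ ≤ D.N v))
    (hw : ∀ u v, Nmin U d p δ ≤ D.N u → θ u ≠ θ v →
      ((D.graph p α lam δ γhat ω).Adj u v ↔
        ‖θ u - θ v‖ ≤ γhat ∧ D.pairRate u v ≤ αw u v * (γhat - γ) ∧ Nmin U d p δ ≤ D.N v)) :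
    D.ThresholdDescription θ p α lam δ γhat γ αr αw ω := by
  have hne (u v) : γ ≤ ‖θ u - θ v‖ ↔ θ u ≠ θ v :=
    ⟨fun h => sub_ne_zero.1 (norm_pos_iff.1 (hγ.trans_le h)), hgap u v⟩
  refine fun u => ⟨fun hNu => ⟨?_, ?_⟩, fun hNu => ⟨?_, ?_⟩⟩
  · rw [Dataset.R_eq_union_adj]
    ext v
    simp only [mem_union, mem_singleton_iff, mem_ofPred_eq]
    grind
  · rw [Dataset.W_eq_setOf_adj]
    ext v
    simp only [mem_ofPred_eq, hne, and_assoc]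
    exact and_congr_right (hw u v hNu)
  · rw [Dataset.R_eq_union_adj, union_eq_left]
    exact fun v hv => absurd (Dataset.Nmin_le_of_adj hv.2).1 hNu.not_ge
  · rw [Dataset.W_eq_setOf_adj, eq_empty_iff_forall_notMem]
    exact fun v hv => hNu.not_ge (Dataset.Nmin_le_of_adj hv.2).1

end GraphDescription

end OffClusBand

end

theorem mainTheorem4_general {Ω : Type*} [MeasurableSpace Ω] (μ : Measure Ω)
    [IsProbabilityMeasure μ] {U d : ℕ} (hd : 0 < d) (D : OffClusBand.Dataset Ω U d)
    (θ : Fin U → OffClusBand.Vec d) (hθ : ∀ u, ‖θ u‖ ≤ 1)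
    (γ : ℝ) (hγ : 0 < γ) (hgap : ∀ u v, θ u ≠ θ v → γ ≤ ‖θ u - θ v‖)
    (ρ : Measure (OffClusBand.Vec d)) (lamA σ : ℝ) (S : ℕ)
    (hρ : OffClusBand.LowerRegularLaw ρ lamA σ)
    (hsel : OffClusBand.SelectedFromCandidates μ D ρ S)
    (lamT : ℝ) (hlamT_pos : 0 < lamT) (hlamT : lamT ≤ OffClusBand.smoothedRegularity lamA σ S)
    (hrew : OffClusBand.SubGaussianRewards μ D θ)
    (α lam δ γhat : ℝ) (hα : 1 ≤ α) (hlam : 0 < lam) (hδ0 : 0 < δ) (hδ1 : δ < 1)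
    (hlam_le : ∀ u, OffClusBand.Nmin U d lamT δ ≤ D.N u →
      lam ≤ d * Real.log (1 + D.N u / (lam * d)) + 2 * Real.log (2 * U / δ))
    (hδ_le : ∀ u, OffClusBand.Nmin U d lamT δ ≤ D.N u → δ ≤ 2 * U / (1 + D.N u / (lam * d))) :
    ∃ αr αw : Fin U → Fin U → Ω → ℝ,
      (∀ u v, Measurable (αr u v) ∧ Measurable (αw u v)) ∧
      (∀ u v ω, αr u v ω ∈ Ico (OffClusBand.homogeneousFactorLower U d lamT α δ)
        (OffClusBand.homogeneousFactorUpper U lamT α δ)) ∧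
      (∀ u v ω, 0 < αw u v ω ∧
        (1 < α → αw u v ω ≤ OffClusBand.heterogeneousFactorUpper U lamT α δ)) ∧
      1 - δ ≤ μ.real {ω | D.ThresholdDescription θ lamT α lam δ γhat γ
        (fun u v => αr u v ω) (fun u v => αw u v ω) ω} := by
  have hα0 : 0 < α := one_pos.trans_le hα
  have hNmin (u : Fin U) : 0 < OffClusBand.Nmin U d lamT δ :=
    OffClusBand.Nmin_pos u.pos hd hlamT_pos (hρ.mul_dim_le_one hlamT) hδ0 hδ1
  have hCI (u) (hNu : OffClusBand.Nmin U d lamT δ ≤ D.N u) :=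
    D.sqrt_mul_CI_le hlamT_pos hlam (OffClusBand.Dataset.pos_of_Nmin_le (hNmin u) hNu) hδ0 hδ1
      (hlam_le u hNu) (hδ_le u hNu)
  choose αr hαr_meas hαr_mem hαr using fun u => OffClusBand.exists_homogeneousFactor (D := D)
    (θ := θ) (γhat := γhat) hlamT_pos hlam hα0 hδ0 hδ1 (hNmin u) hCI u
  choose αw hαw_meas hαw_mem hαw using fun u => OffClusBand.exists_heterogeneousFactor (D := D)
    (γhat := γhat) hlamT_pos hlam hα hδ0 hδ1 (hNmin u) hgap u
  refine ⟨αr, αw, fun u v => ⟨hαr_meas u v, hαw_meas u v⟩, hαr_mem, hαw_mem, ?_⟩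
  have hbad := OffClusBand.measureReal_not_ridgeAccurate_le hρ hd hsel hrew hθ hlamT_pos hlamT
    hlam hδ0 hδ1
  have hgood : {ω | D.RidgeAccurate θ lamT lam δ ω} ⊆ {ω | D.ThresholdDescription θ lamT α lam δ
      γhat γ (fun u v => αr u v ω) (fun u v => αw u v ω) ω} := fun ω hacc =>
    OffClusBand.Dataset.thresholdDescription_of_adj_iff hγ hgap (hαr · · ω hacc) (hαw · · ω hacc)
  have hcover : 1 ≤ μ.real {ω | D.RidgeAccurate θ lamT lam δ ω} +
      μ.real {ω | ¬ D.RidgeAccurate θ lamT lam δ ω} := by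
    rw [← probReal_univ (μ := μ), ← union_compl_self {ω | D.RidgeAccurate θ lamT lam δ ω}]
    exact measureReal_union_le _ _
  linarith [measureReal_mono (μ := μ) hgood]

theorem mainTheorem4 {Ω : Type*} [MeasurableSpace Ω] (μ : Measure Ω) [IsProbabilityMeasure μ]
    {U d : ℕ} (D : OffClusBand.Dataset Ω U d)
    -- preference vectors in the unit ball, with heterogeneity gap `γ`
    (θ : Fin U → OffClusBand.Vec d) (hθ : ∀ u, ‖θ u‖ ≤ 1)
    (γ : ℝ) (hγ : 0 < γ) (hgap : ∀ u v, θ u ≠ θ v → γ ≤ ‖θ u - θ v‖)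
    -- action regularity, with smoothed regularity parameter `lamT`
    (ρ : Measure (OffClusBand.Vec d)) (lamA σ : ℝ) (S : ℕ)
    (hρ : OffClusBand.RegularLaw ρ lamA σ)
    (hsel : OffClusBand.SelectedFromCandidates μ D ρ S)
    (lamT : ℝ) (hlamT : lamT = OffClusBand.smoothedRegularity lamA σ S)
    -- 1-sub-Gaussian rewards
    (hrew : OffClusBand.SubGaussianRewards μ D θ)
    -- inputs of the algorithm
    (α lam δ γhat : ℝ) (hα : 1 ≤ α) (hlam : 0 < lam) (hδ0 : 0 < δ) (hδ1 : δ < 1)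
    (hγhat : 0 ≤ γhat)
    (hlam_le : lam ≤ d * Real.log (1 + ((⨅ u, D.N u : ℕ) : ℝ) / (lam * d)) +
      2 * Real.log (2 * U / δ))
    (hδ_le : δ ≤ 2 * U / (1 + ((⨆ u, D.N u : ℕ) : ℝ) / (lam * d))) :
    ∃ αr αw : Fin U → Fin U → Ω → ℝ,
      (∀ u v, Measurable (αr u v) ∧ Measurable (αw u v)) ∧
      (∀ u v ω, αr u v ω ∈ Set.Ico
        (Real.sqrt lamT / (4 * (α + 1) * Real.sqrt (Real.log (2 * U / δ) * max 2 (d : ℝ))))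
        (Real.sqrt lamT / (2 * α * Real.sqrt (Real.log (2 * U / δ))))) ∧
      (∀ u v ω, 0 < αw u v ω ∧
        -- for `α = 1` the upper end of the range is `+∞`
        (1 < α → αw u v ω ≤
          Real.sqrt lamT / (2 * (α - 1) * Real.sqrt (Real.log (2 * U / δ))))) ∧
      1 - δ ≤ μ.real {ω | ∀ u,
        (OffClusBand.Nmin U d lamT δ ≤ D.N u →
          D.R θ lamT α lam δ γhat u ω = {u} ∪ {v | θ u = θ v ∧
            1 / Real.sqrt (D.N u) + 1 / Real.sqrt (D.N v) ≤ αr u v ω * γhat ∧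
            OffClusBand.Nmin U d lamT δ ≤ D.N v} ∧
          D.W θ lamT α lam δ γhat u ω = {v | (γ ≤ ‖θ u - θ v‖ ∧ ‖θ u - θ v‖ ≤ γhat) ∧
            1 / Real.sqrt (D.N u) + 1 / Real.sqrt (D.N v) ≤ αw u v ω * (γhat - γ) ∧
            OffClusBand.Nmin U d lamT δ ≤ D.N v}) ∧
        (D.N u < OffClusBand.Nmin U d lamT δ →
          D.R θ lamT α lam δ γhat u ω = {u} ∧ D.W θ lamT α lam δ γhat u ω = ∅)} := by
  obtain ⟨αr, αw, hmeas, hr, hw, hprob⟩ := mainTheorem4_general μ hρ.dim_pos D θ hθ γ hγ hgap ρ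
    lamA σ S hρ.toLowerRegularLaw hsel lamT
    (hlamT ▸ OffClusBand.smoothedRegularity_pos hρ.lamA_pos hρ.sigma_pos S) hlamT.le hrew α lam δ
    γhat hα hlam hδ0 hδ1
    (fun u _ => hlam_le.trans (by gcongr; exact ciInf_le' D.N u))
    (fun u _ => hδ_le.trans (by
      gcongr; exact_mod_cast le_ciSup (Set.finite_range D.N).bddAbove u))
  exact ⟨αr, αw, hmeas, hr, hw, hprob⟩
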